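/- Let $(\mathbf{B},\|\cdot\|)$ be a real separable Banach space with its Borel $\sigma$-algebra. Let $\{a_n;\,n\ge 1\}$ and $\{b_n;\,n\ge 1\}$ be increasing (in the weak sense, i.e. nondecreasing) sequences of positive real numbers such that $\lim_{n\to\infty}a_n=\infty$ and $\{b_n/a_n;\,n\ge1\}$ is nondecreasing. For a sequence $\{X,X_n;\,n\ge1\}$ of independent and identically distributed (i.i.d.) $\mathbf{B}$-valued random variables, where $X$ denotes a generic copy of the $X_n$, write $S_n=\sum_{i=1}^n X_i$ and $\gamma_n=n\,\mathbb{E}\left(X\,I\{\|X\|\le b_n\}\right)$, $n\ge1$; the sequence is called symmetric if $X$ and $-X$ have the same distribution. Suppose that for every symmetric sequence $\{X,X_n;\,n\ge1\}$ of i.i.d. $\mathbf{B}$-valued random variables, $$\lim_{n\to\infty}\frac{S_n}{a_n}=0\ \text{ a.s. whenever }\ \sum_{n=1}^\infty\mathbb{P}(\|X\|>a_n)<\infty .$$ Then, for every sequence $\{X,X_n;\,n\ge1\}$ of i.i.d. $\mathbf{B}$-valued random variables: (i) if $\sum_{n=1}^\infty\mathbb{P}(\|X\|>b_n)<\infty$,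 then $\displaystyle\lim_{n\to\infty}\frac{S_n-\gamma_n}{b_n}=0$ a.s.; (ii) if $\sum_{n=1}^\infty\mathbb{P}(\|X\|>b_n)=\infty$, then $\displaystyle\limsup_{n\to\infty}\frac{\|S_n-\gamma_n\|}{b_n}=\infty$ a.s. -/

import Mathlib

open MeasureTheory ProbabilityTheory Filter Topology
open scoped ENNReal

universe u v

noncomputable section

namespace FellerSLLN

/-- `X 0, X 1, X 2, …` is an i.i.d. sequence of `B`-valued random variables on `(Ω, P)`.
The sequence is enumerated from `0`: the variable `X i` is the one usually written `X_{i+1}`,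
and `X 0` serves as the generic copy `X`. -/
structure IsIID {Ω B : Type*} [MeasurableSpace Ω] [MeasurableSpace B]
    (P : Measure Ω) (X : ℕ → Ω → B) : Prop where
  measurable : ∀ i, Measurable (X i)
  indep : iIndepFun X P
  identDistrib : ∀ i, IdentDistrib (X i) (X 0) P P

/-- A `B`-valued random variable is symmetric: it has the same distribution as its negative. -/
def IsSymmetric {Ω B : Type*} [MeasurableSpace Ω] [MeasurableSpace B] [Neg B]
    (P : Measure Ω) (Y : Ω → B) : Prop :=
  IdentDistrib Y (fun ω => -Y ω) P P

/-- The partial sum `S_n`, the sum of the first `n` variables. -/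
def partialSum {Ω B : Type*} [AddCommMonoid B] (X : ℕ → Ω → B) (n : ℕ) (ω : Ω) : B :=
  ∑ i ∈ Finset.range n, X i ω

/-- The series `∑_{n ≥ 1} P(‖Y‖ > c_n)`, valued in `[0, ∞]`. -/
def tailSeries {Ω B : Type*} [MeasurableSpace Ω] [Norm B]
    (P : Measure Ω) (Y : Ω → B) (c : ℕ → ℝ) : ℝ≥0∞ :=
  ∑' n : ℕ, P {ω | c (n + 1) < ‖Y ω‖}

/-- The centering `γ_n = n E(Y I{‖Y‖ ≤ b_n})`. -/
def centering {Ω B : Type*} [MeasurableSpace Ω] [NormedAddCommGroup B] [NormedSpace ℝ B]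
    (P : Measure Ω) (Y : Ω → B) (b : ℕ → ℝ) (n : ℕ) : B :=
  (n : ℝ) • ∫ ω, {ω' | ‖Y ω'‖ ≤ b n}.indicator Y ω ∂P

/-- For every symmetric i.i.d. sequence of `B`-valued random variables (on any probability
space), `S_n / a_n → 0` a.s. whenever `∑ P(‖X‖ > a_n) < ∞`. The universe of `B` suffices for
the probability spaces, since every law on `B` has an i.i.d. realization on `ℕ → B`. -/
def SymmetricSLLN (B : Type u) [NormedAddCommGroup B] [NormedSpace ℝ B] [MeasurableSpace B]
    (a : ℕ → ℝ) : Prop :=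
  ∀ (Ω : Type u) [MeasurableSpace Ω] (P : Measure Ω) [IsProbabilityMeasure P]
    (X : ℕ → Ω → B), IsIID P X → IsSymmetric P (X 0) → tailSeries P (X 0) a < ∞ →
    ∀ᵐ ω ∂P, Tendsto (fun n : ℕ => (a n)⁻¹ • partialSum X n ω) atTop (𝓝 0)

end FellerSLLN

end

/-! The core is the passage from `a` to `b` for symmetric sequences. A monotone function `W`, built
by `exists_ratio_function`, reads off `b / a` at the scale of a given norm. The odd map `x ↦ x / W
‖x‖` turns the tail condition at `b` into the tail condition at `a`, so the hypothesis makes the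
transformed partial sums `o(a n)`. The even factors `W ‖x‖ / (b / a)`, capped at 1, preserve this by
the contraction principle `ae_tendsto_contraction`. Summation by parts with the nondecreasing
weights `b / a` then raises `o(a n)` to `o(b n)`. By Borel–Cantelli the resulting summands are
eventually the original `X i`. A constant multiple of `b` serves equally well, because its ratio to
`a` is still monotone.

For a general sequence, this applies to the difference of two independent copies. By Fubini, almost
every path of one copy provides centering constants `c n` with `S n - c n = o(b n)`. To replace `c
n` by the truncated means, `integral_norm_partialSum_le` upgrades convergence in probability of the
truncated symmetrized sums to convergence in mean. Jensen's inequality and Markov's inequality then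
place the truncated sum near its mean. With positive probability it is also near `c n`, hence `c n`
is near the mean.

Divergence is proved by contraposition. If the centered sums are `O(b n)` with positive probability,
the second Borel–Cantelli lemma gives a convergent tail series for the symmetrized variable at some
large multiple of `b`. The symmetric law then applies at that multiple and shows that the
symmetrized sums are `o(b n)`. A second use of Borel–Cantelli brings the multiple down to `1 / 2`,
which is small enough to desymmetrize. -/

namespace FellerSLLN

/-! ### Sign vectors: reflection and contraction by counting. -/

section Cube

variable {E : Type*} [AddCommGroup E] [Module ℝ E]

/-- Summation by parts: a weighted sum with antitone weights in `[0, 1]` is a convex combination of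
the unweighted partial sums. -/
lemma sum_smul_mem_of_partialSums_mem {K : Set E} (hK : Convex ℝ K) (n : ℕ) (y : ℕ → E)
    (d : ℕ → ℝ) (hd0 : ∀ i < n, 0 ≤ d i) (hd1 : ∀ i < n, d i ≤ 1)
    (hd : ∀ i j, i ≤ j → j < n → d j ≤ d i)
    (hS : ∀ k ≤ n, ∑ i ∈ Finset.range k, y i ∈ K) :
    ∑ i ∈ Finset.range n, d i • y i ∈ K := by
  -- The weights are padded by 1 in front and 0 behind. The successive differences of `e` are the
  -- convex coefficients, and the term `k = 0` carries the empty partial sum.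
  let e : ℕ → ℝ := fun k => if k = 0 then 1 else if k ≤ n then d (k - 1) else 0
  have he : ∀ k ≤ n, e (k + 1) ≤ e k := by
    intro k hk
    rcases Nat.eq_zero_or_pos k with rfl | hk0
    · by_cases h : 1 ≤ n
      · simpa [e, h] using hd1 0 h
      · simp [e, h]
    · by_cases h : k + 1 ≤ n
      · simpa [e, h, hk, hk0.ne'] using hd (k - 1) k (by omega) (by omega)
      · simpa [e, h, hk, hk0.ne'] using hd0 (k - 1) (by omega)
  have hsum : ∑ k ∈ Finset.range (n + 1), (e k - e (k + 1)) = 1 := by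
    rw [Finset.sum_range_sub']
    simp [e]
  have key : ∀ m ≤ n, ∑ k ∈ Finset.range (m + 1), (e k - e (k + 1)) • ∑ i ∈ Finset.range k, y i
      = ∑ i ∈ Finset.range m, d i • y i - e (m + 1) • ∑ i ∈ Finset.range m, y i := by
    intro m
    induction m with
    | zero => simp
    | succ m ih =>
      intro hm
      rw [Finset.sum_range_succ, ih (by omega), Finset.sum_range_succ _ m,
        Finset.sum_range_succ _ m]
      have : e (m + 1) = d m := by simp [e, hm]
      rw [this, sub_smul, smul_add, smul_add]
      abel
  have h := key n le_rfl
  have hlast : e (n + 1) = 0 := by simp [e]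
  rw [hlast, zero_smul, sub_zero] at h
  rw [← h]
  refine hK.sum_mem (fun k hk => ?_) hsum (fun k hk => hS k ?_)
  · have := he k (by simpa [Nat.lt_succ_iff] using hk)
    linarith
  · simpa [Nat.lt_succ_iff] using hk

open Classical in
/-- Lévy's maximal inequality for sign vectors, for a convex symmetric set. -/
lemma card_exists_partialSum_notMem_le {K : Set E} (hK : Convex ℝ K) (n : ℕ) (y : Fin n → E) :
    (Finset.univ.filter fun s : Fin n → ℤˣ =>
        ∃ k ≤ n, ∑ i with i.val < k, s i • y i ∉ K).card
      ≤ 2 * (Finset.univ.filter fun s : Fin n → ℤˣ => ∑ i, s i • y i ∉ K).card := by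
  set Bad := Finset.univ.filter fun s : Fin n → ℤˣ =>
        ∃ k ≤ n, ∑ i with i.val < k, s i • y i ∉ K with hBad
  set A := Finset.univ.filter fun s : Fin n → ℤˣ => ∑ i, s i • y i ∉ K with hA
  let p : (Fin n → ℤˣ) → ℕ → Prop := fun s k => k ≤ n ∧ ∑ i with i.val < k, s i • y i ∉ K
  -- `τ` is the first exit time from `K`; the default 0 plays no role on `Bad`. `Φ` flips the signs
  -- from `τ` on. Since it preserves `τ` on `Bad`, it is injective there.
  let τ : (Fin n → ℤˣ) → ℕ := fun s => if h : ∃ k, p s k then Nat.find h else 0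
  let Φ : (Fin n → ℤˣ) → (Fin n → ℤˣ) := fun s i => if i.val < τ s then s i else - s i
  have hsum : ∀ s, ∀ k ≤ τ s, ∑ i with i.val < k, Φ s i • y i = ∑ i with i.val < k, s i • y i := by
    intro s k hk
    refine Finset.sum_congr rfl fun i hi => ?_
    have : i.val < τ s := lt_of_lt_of_le (by simpa using hi) hk
    simp [Φ, this]
  have hpiff : ∀ s, ∀ k ≤ τ s, (p (Φ s) k ↔ p s k) := by
    intro s k hk
    simp only [p, hsum s k hk]
  have hτ : ∀ s ∈ Bad, τ (Φ s) = τ s := by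
    intro s hs
    have h : ∃ k, p s k := by simpa [hBad, p] using hs
    have hτs : τ s = Nat.find h := by simp [τ, h]
    have hspec : p s (τ s) := by rw [hτs]; exact Nat.find_spec h
    have h' : ∃ k, p (Φ s) k := ⟨τ s, (hpiff s _ le_rfl).2 hspec⟩
    have hτs' : τ (Φ s) = Nat.find h' := by simp only [τ, dif_pos h']
    rw [hτs', Nat.find_eq_iff]
    refine ⟨(hpiff s _ le_rfl).2 hspec, fun k hk => ?_⟩
    rw [hpiff s k hk.le]
    rw [hτs] at hk
    exact Nat.find_min h hk
  have hinj : Set.InjOn Φ Bad := by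
    intro s hs s' hs' h
    have h1 := hτ s hs
    have h2 := hτ s' hs'
    rw [h, h2] at h1
    funext i
    have := congrFun h i
    simp only [Φ, h1] at this
    split_ifs at this with hi
    · exact this
    · exact neg_injective this
  have hcover : Bad ⊆ A ∪ Bad.filter (fun s => Φ s ∈ A) := by
    intro s hs
    by_contra hcon
    have h1 : s ∉ A := fun h => hcon (Finset.mem_union_left _ h)
    have h2 : Φ s ∉ A := fun h =>
      hcon (Finset.mem_union_right _ (Finset.mem_filter.2 ⟨hs, h⟩))
    have h : ∃ k, p s k := by simpa [hBad, p] using hs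
    have hτs : τ s = Nat.find h := by simp [τ, h]
    have hspec : p s (τ s) := by rw [hτs]; exact Nat.find_spec h
    simp only [hA, Finset.mem_filter, Finset.mem_univ, true_and, not_not] at h1 h2
    apply hspec.2
    -- The midpoint of the full sums for `s` and `Φ s` is the partial sum at the exit time, so
    -- convexity alone excludes both lying in `K`.
    have hmid := hK h1 h2 (by norm_num : (0 : ℝ) ≤ 1 / 2) (by norm_num : (0 : ℝ) ≤ 1 / 2)
      (by norm_num)
    convert hmid using 1
    rw [← smul_add, ← Finset.sum_add_distrib]
    have : ∀ i, s i • y i + Φ s i • y i = if i.val < τ s then (2 : ℝ) • (s i • y i) else 0 := by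
      intro i
      by_cases hi : i.val < τ s
      · simp [Φ, hi, two_smul]
      · simp [Φ, hi]
    simp_rw [this]
    rw [← Finset.sum_filter, ← Finset.smul_sum, smul_smul]
    norm_num
  calc Bad.card ≤ (A ∪ Bad.filter (fun s => Φ s ∈ A)).card := Finset.card_le_card hcover
    _ ≤ A.card + (Bad.filter (fun s => Φ s ∈ A)).card := Finset.card_union_le _ _
    _ ≤ A.card + A.card := by
      refine Nat.add_le_add_left ?_ _
      refine Finset.card_le_card_of_injOn Φ (fun s hs => ?_) (hinj.mono fun s hs => ?_)
      · simpa using (Finset.mem_filter.1 hs).2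
      · exact (Finset.mem_filter.1 hs).1
    _ = 2 * A.card := by ring

open Classical in
/-- Contraction principle for sign vectors, for a convex set and sorted weights. -/
lemma card_smul_sum_notMem_le_of_antitone {K : Set E} (hK : Convex ℝ K) (n : ℕ)
    (y : Fin n → E) (d : Fin n → ℝ) (hd0 : ∀ i, 0 ≤ d i) (hd1 : ∀ i, d i ≤ 1) (hd : Antitone d) :
    (Finset.univ.filter fun s : Fin n → ℤˣ => ∑ i, d i • s i • y i ∉ K).card
      ≤ 2 * (Finset.univ.filter fun s : Fin n → ℤˣ => ∑ i, s i • y i ∉ K).card := by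
  refine le_trans (Finset.card_le_card fun s hs => ?_) (card_exists_partialSum_notMem_le hK n y)
  simp only [Finset.mem_filter, Finset.mem_univ, true_and] at hs ⊢
  by_contra! hcon
  apply hs
  let y' : ℕ → E := fun i => if h : i < n then s ⟨i, h⟩ • y ⟨i, h⟩ else 0
  let d' : ℕ → ℝ := fun i => if h : i < n then d ⟨i, h⟩ else 0
  have h := sum_smul_mem_of_partialSums_mem hK n y' d' (fun i hi => by simp [d', hi, hd0])
    (fun i hi => by simp [d', hi, hd1])
    (fun i j hij hj => by
      have hi : i < n := lt_of_le_of_lt hij hj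
      simp only [d', hi, hj, dif_pos]
      exact hd (by simpa using hij))
    (fun k hk => by
      have := hcon k hk
      convert this using 1
      have hk' : ∑ i ∈ Finset.range k, y' i
          = ∑ i ∈ Finset.range n, if i < k then y' i else 0 := by
        rw [← Finset.sum_filter]
        congr 1
        ext i
        simp only [Finset.mem_range, Finset.mem_filter]
        omega
      rw [hk', Finset.sum_filter, ← Fin.sum_univ_eq_sum_range]
      simp [y'])
  rw [← Fin.sum_univ_eq_sum_range] at h
  simpa [y', d'] using h

open Classical in
/-- Contraction principle for sign vectors, for a convex set. -/
lemma card_smul_sum_notMem_le {K : Set E} (hK : Convex ℝ K) (n : ℕ)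
    (y : Fin n → E) (d : Fin n → ℝ) (hd0 : ∀ i, 0 ≤ d i) (hd1 : ∀ i, d i ≤ 1) :
    (Finset.univ.filter fun s : Fin n → ℤˣ => ∑ i, d i • s i • y i ∉ K).card
      ≤ 2 * (Finset.univ.filter fun s : Fin n → ℤˣ => ∑ i, s i • y i ∉ K).card := by
  -- Permuting coordinates is a bijection of the sign cube, so the weights may be assumed sorted.
  let σ : Equiv.Perm (Fin n) := Tuple.sort (fun i => - d i)
  have hσ : Antitone (d ∘ σ) := by
    intro i j hij
    have := Tuple.monotone_sort (fun i => - d i) hij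
    simpa using this
  have h := card_smul_sum_notMem_le_of_antitone hK n (y ∘ σ) (d ∘ σ) (fun i => hd0 _)
    (fun i => hd1 _) hσ
  let e : (Fin n → ℤˣ) ≃ (Fin n → ℤˣ) := Equiv.arrowCongr σ.symm (Equiv.refl _)
  have he : ∀ s i, e s i = s (σ i) := fun s i => by simp [e]
  have h1 : (Finset.univ.filter fun s : Fin n → ℤˣ => ∑ i, d i • s i • y i ∉ K).card
      = (Finset.univ.filter fun s : Fin n → ℤˣ =>
          ∑ i, (d ∘ σ) i • s i • (y ∘ σ) i ∉ K).card := by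
    refine Finset.card_equiv e fun s => ?_
    simp only [Finset.mem_filter, Finset.mem_univ, true_and, he, Function.comp]
    rw [Equiv.sum_comp σ (fun i => d i • s i • y i)]
  have h2 : (Finset.univ.filter fun s : Fin n → ℤˣ => ∑ i, s i • y i ∉ K).card
      = (Finset.univ.filter fun s : Fin n → ℤˣ => ∑ i, s i • (y ∘ σ) i ∉ K).card := by
    refine Finset.card_equiv e fun s => ?_
    simp only [Finset.mem_filter, Finset.mem_univ, true_and, he, Function.comp]
    rw [Equiv.sum_comp σ (fun i => s i • y i)]
  rw [h1, h2]
  exact h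

end Cube

/-! ### The contraction principle for independent symmetric vectors. -/

section Contraction

variable {Ω : Type*} [MeasurableSpace Ω] {P : Measure Ω}

/-- Almost sure convergence to zero passes from `G` to `H` if the maxima of `H` over finite
windows are stochastically dominated, up to a factor two, by those of `G`. -/
lemma ae_tendsto_zero_of_measure_window_le [IsProbabilityMeasure P] {G H : ℕ → Ω → ℝ}
    (hG : ∀ n, Measurable (G n)) (hH0 : ∀ n ω, 0 ≤ H n ω)
    (hle : ∀ t > 0, ∀ m N, P {ω | ∃ n, m ≤ n ∧ n ≤ N ∧ t < H n ω}
      ≤ 2 * P {ω | ∃ n, m ≤ n ∧ n ≤ N ∧ t < G n ω})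
    (hlim : ∀ᵐ ω ∂P, Tendsto (fun n => G n ω) atTop (𝓝 0)) :
    ∀ᵐ ω ∂P, Tendsto (fun n => H n ω) atTop (𝓝 0) := by
  have htail : ∀ t > 0, ∀ m, P {ω | ∃ n, m ≤ n ∧ t < H n ω}
      ≤ 2 * P {ω | ∃ n, m ≤ n ∧ t < G n ω} := by
    intro t ht m
    have hU : {ω | ∃ n, m ≤ n ∧ t < H n ω} = ⋃ N, {ω | ∃ n, m ≤ n ∧ n ≤ N ∧ t < H n ω} := by
      ext ω
      simp only [Set.mem_ofPred_eq, Set.mem_iUnion]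
      exact ⟨fun ⟨n, h1, h2⟩ => ⟨n, n, h1, le_rfl, h2⟩, fun ⟨_, n, h1, _, h2⟩ => ⟨n, h1, h2⟩⟩
    have hmono : Monotone fun N => {ω | ∃ n, m ≤ n ∧ n ≤ N ∧ t < H n ω} := by
      rintro N N' hN ω ⟨n, h1, h2, h3⟩
      exact ⟨n, h1, h2.trans hN, h3⟩
    rw [hU, hmono.measure_iUnion]
    refine iSup_le fun N => (hle t ht m N).trans ?_
    exact mul_le_mul' le_rfl (measure_mono fun ω ⟨n, h1, _, h3⟩ => ⟨n, h1, h3⟩)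
  have hnull : ∀ t > 0, P {ω | ∃ᶠ n in atTop, t < H n ω} = 0 := by
    intro t ht
    have hA : Tendsto (fun m => P {ω | ∃ n, m ≤ n ∧ t < G n ω}) atTop (𝓝 (P ∅)) := by
      refine tendsto_measure_of_ae_tendsto_indicator_of_isFiniteMeasure atTop .empty
        (fun m => ?_) ?_
      · have : {ω | ∃ n, m ≤ n ∧ t < G n ω} = ⋃ n, ⋃ (_ : m ≤ n), {ω | t < G n ω} := by
          ext ω; simp
        rw [this]
        exact .iUnion fun n => .iUnion fun _ => measurableSet_lt measurable_const (hG n)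
      · filter_upwards [hlim] with ω hω
        obtain ⟨m₀, hm₀⟩ := eventually_atTop.1 (hω.eventually (gt_mem_nhds ht))
        filter_upwards [eventually_ge_atTop m₀] with m hm
        simp only [Set.mem_empty_iff_false, iff_false, not_exists, not_and,
          not_lt]
        exact fun n hn => (hm₀ n (hm.trans hn)).le
    have h2 : Tendsto (fun m => 2 * P {ω | ∃ n, m ≤ n ∧ t < G n ω}) atTop (𝓝 0) := by
      have := ENNReal.Tendsto.const_mul (a := 2) hA (Or.inr (by simp))
      simpa using this
    refine le_antisymm (ge_of_tendsto' h2 fun m => ?_) zero_le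
    refine le_trans (measure_mono fun ω hω => ?_) (htail t ht m)
    obtain ⟨n, h1, h2⟩ := frequently_atTop.1 hω m
    exact ⟨n, h1, h2⟩
  have hall : ∀ᵐ ω ∂P, ∀ j : ℕ, ∀ᶠ n in atTop, H n ω ≤ 1 / ((j : ℝ) + 1) := by
    rw [ae_all_iff]
    intro j
    have := hnull (1 / ((j : ℝ) + 1)) (by positivity)
    rw [ae_iff]
    simpa only [not_eventually, not_le] using this
  filter_upwards [hall] with ω hω
  rw [Metric.tendsto_atTop']
  intro ε hε
  obtain ⟨j, hj⟩ := exists_nat_one_div_lt hε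
  obtain ⟨m, hm⟩ := eventually_atTop.1 (hω j)
  refine ⟨m, fun n hn => ?_⟩
  rw [Real.dist_eq, sub_zero, abs_of_nonneg (hH0 n ω)]
  exact (hm n hn.le).trans_lt hj

variable {B : Type*} [NormedAddCommGroup B] [NormedSpace ℝ B] [MeasurableSpace B] [BorelSpace B]

omit [NormedSpace ℝ B] in
-- Each marginal is sign invariant and the joint law is their product. This permits averaging over
-- all sign vectors.
lemma map_units_smul_eq [IsProbabilityMeasure P] {X : ℕ → Ω → B} (hX : ∀ i, Measurable (X i))
    (hind : iIndepFun X P) (hsymm : ∀ i, IsSymmetric P (X i)) (N : ℕ) (s : Fin N → ℤˣ) :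
    P.map (fun ω (i : Fin N) => s i • X i ω) = P.map (fun ω (i : Fin N) => X i ω) := by
  have hm : ∀ i : Fin N, Measurable fun x : B => s i • x := by
    intro i
    rcases Int.units_eq_one_or (s i) with h | h <;> simp only [h, one_smul, Units.neg_smul]
    · exact measurable_id
    · exact measurable_neg
  have h0 : iIndepFun (fun i : Fin N => X i) P := hind.precomp Fin.val_injective
  have h1 : iIndepFun (fun (i : Fin N) ω => s i • X i ω) P :=
    h0.comp (fun i x => s i • x) hm
  have hsX : ∀ i : Fin N, Measurable fun ω => s i • X i ω := fun i => (hm i).comp (hX i)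
  rw [h1.map_fun_eq_pi_map (fun i => (hsX i).aemeasurable),
    h0.map_fun_eq_pi_map (fun i : Fin N => (hX i).aemeasurable)]
  congr 1
  funext i
  rcases Int.units_eq_one_or (s i) with h | h
  · simp [h]
  · simpa [h] using (hsymm i).map_eq.symm

open Classical in
/-- Contraction principle: shrinking independent symmetric vectors by even factors in `[0, 1]`
at most doubles the probability of leaving a convex set. -/
lemma measure_contraction_notMem_le [SecondCountableTopology B] [IsProbabilityMeasure P]
    {X : ℕ → Ω → B} (hX : ∀ i, Measurable (X i)) (hind : iIndepFun X P)
    (hsymm : ∀ i, IsSymmetric P (X i)) {f : B → B} (hf : Measurable f) (hodd : ∀ x, f (-x) = -f x)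
    {d : ℕ → B → ℝ} (hd : ∀ i, Measurable (d i)) (heven : ∀ i x, d i (-x) = d i x)
    (hd0 : ∀ i x, 0 ≤ d i x) (hd1 : ∀ i x, d i x ≤ 1) (N : ℕ) {K : Set (Fin N → B)}
    (hK : Convex ℝ K) (hKm : MeasurableSet K) :
    P {ω | (fun i : Fin N => d i (X i ω) • f (X i ω)) ∉ K}
      ≤ 2 * P {ω | (fun i : Fin N => f (X i ω)) ∉ K} := by
  have hXN : Measurable fun ω (i : Fin N) => X i ω := measurable_pi_lambda _ fun i => hX i
  have hsX : ∀ s : Fin N → ℤˣ, Measurable fun ω (i : Fin N) => s i • X i ω := by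
    intro s
    refine measurable_pi_lambda _ fun i => ?_
    rcases Int.units_eq_one_or (s i) with h | h <;> simp only [h, one_smul, Units.neg_smul]
    · exact hX i
    · exact (hX i).neg
  let A₁ : Set (Fin N → B) := {x | (fun i : Fin N => d i (x i) • f (x i)) ∉ K}
  let A₂ : Set (Fin N → B) := {x | (fun i : Fin N => f (x i)) ∉ K}
  have hA₁ : MeasurableSet A₁ := by
    have : Measurable fun (x : Fin N → B) (i : Fin N) => d i (x i) • f (x i) :=
      measurable_pi_lambda _ fun i =>
        ((hd i).comp (measurable_pi_apply i)).smul (hf.comp (measurable_pi_apply i))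
    exact (this hKm).compl
  have hA₂ : MeasurableSet A₂ := by
    have : Measurable fun (x : Fin N → B) (i : Fin N) => f (x i) :=
      measurable_pi_lambda _ fun i => hf.comp (measurable_pi_apply i)
    exact (this hKm).compl
  have hinv : ∀ A : Set (Fin N → B), MeasurableSet A → ∀ s : Fin N → ℤˣ,
      P {ω | (fun i : Fin N => X i ω) ∈ A} = P {ω | (fun i : Fin N => s i • X i ω) ∈ A} := by
    intro A hA s
    have h := congrArg (fun μ : Measure (Fin N → B) => μ A) (map_units_smul_eq hX hind hsymm N s)
    simp only [Measure.map_apply (hsX s) hA, Measure.map_apply hXN hA] at h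
    exact h.symm
  -- The probability of `A` is the mean proportion of sign vectors sending the path into `A`. The
  -- claim thereby reduces to counting signs for one fixed path.
  have havg : ∀ A : Set (Fin N → B), MeasurableSet A →
      (Fintype.card (Fin N → ℤˣ) : ℝ≥0∞) * P {ω | (fun i : Fin N => X i ω) ∈ A}
        = ∫⁻ ω, ((Finset.univ.filter fun s : Fin N → ℤˣ =>
            (fun i : Fin N => s i • X i ω) ∈ A).card : ℝ≥0∞) ∂P := by
    intro A hA
    have h1 : ∀ ω, ((Finset.univ.filter fun s : Fin N → ℤˣ =>
            (fun i : Fin N => s i • X i ω) ∈ A).card : ℝ≥0∞)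
        = ∑ s : Fin N → ℤˣ, {ω | (fun i : Fin N => s i • X i ω) ∈ A}.indicator 1 ω := by
      intro ω
      rw [Finset.card_filter]
      push_cast
      refine Finset.sum_congr rfl fun s _ => ?_
      simp [Set.indicator_apply]
    simp_rw [h1]
    have hms : ∀ s : Fin N → ℤˣ, MeasurableSet {ω | (fun i : Fin N => s i • X i ω) ∈ A} :=
      fun s => hsX s hA
    rw [lintegral_finsetSum _ fun s _ => measurable_one.indicator (hms s)]
    simp_rw [lintegral_indicator_one (hms _)]
    simp_rw [← hinv A hA]
    simp
  have hcard0 : (Fintype.card (Fin N → ℤˣ) : ℝ≥0∞) ≠ 0 := by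
    simp
  have hcardt : (Fintype.card (Fin N → ℤˣ) : ℝ≥0∞) ≠ ∞ := ENNReal.natCast_ne_top _
  rw [← ENNReal.mul_le_mul_iff_right hcard0 hcardt, mul_left_comm]
  have e1 := havg A₁ hA₁
  have e2 := havg A₂ hA₂
  change (Fintype.card (Fin N → ℤˣ) : ℝ≥0∞) * P {ω | (fun i : Fin N => X i ω) ∈ A₁}
    ≤ 2 * ((Fintype.card (Fin N → ℤˣ) : ℝ≥0∞) * P {ω | (fun i : Fin N => X i ω) ∈ A₂})
  rw [e1, e2, ← lintegral_const_mul' _ _ (by simp)]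
  refine lintegral_mono fun ω => ?_
  have hf_s : ∀ (u : ℤˣ) x, f (u • x) = u • f x := by
    intro u x
    rcases Int.units_eq_one_or u with h | h <;> simp [h, hodd]
  have hd_s : ∀ (u : ℤˣ) i x, d i (u • x) = d i x := by
    intro u i x
    rcases Int.units_eq_one_or u with h | h <;> simp [h, heven]
  -- The summands are coordinate vectors of `Fin N → B`, so a signed sum is the whole vector and `K`
  -- may constrain all coordinates jointly.
  have hcube := card_smul_sum_notMem_le hK N (fun i => Pi.single i (f (X i ω)))
    (fun i => d i (X i ω)) (fun i => hd0 _ _) (fun i => hd1 _ _)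
  have c1 : ∀ s : Fin N → ℤˣ, ∑ i : Fin N, d i (X i ω) • s i • (Pi.single i (f (X i ω)) : Fin N → B)
      = fun i : Fin N => d i (s i • X i ω) • f (s i • X i ω) := by
    intro s
    simp_rw [← Pi.single_smul]
    rw [Finset.univ_sum_single]
    funext i
    rw [hd_s, hf_s]
  have c2 : ∀ s : Fin N → ℤˣ, ∑ i : Fin N, s i • (Pi.single i (f (X i ω)) : Fin N → B)
      = fun i : Fin N => f (s i • X i ω) := by
    intro s
    simp_rw [← Pi.single_smul]
    rw [Finset.univ_sum_single]
    funext i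
    rw [hf_s]
  simp_rw [c1, c2] at hcube
  simp only [A₁, A₂, Set.mem_ofPred_eq]
  exact_mod_cast hcube

/-- Almost sure form of the contraction principle for normalized partial sums. -/
lemma ae_tendsto_contraction [SecondCountableTopology B] [IsProbabilityMeasure P]
    {X : ℕ → Ω → B} (hX : ∀ i, Measurable (X i)) (hind : iIndepFun X P)
    (hsymm : ∀ i, IsSymmetric P (X i)) {f : B → B} (hf : Measurable f) (hodd : ∀ x, f (-x) = -f x)
    {d : ℕ → B → ℝ} (hd : ∀ i, Measurable (d i)) (heven : ∀ i x, d i (-x) = d i x)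
    (hd0 : ∀ i x, 0 ≤ d i x) (hd1 : ∀ i x, d i x ≤ 1) {a : ℕ → ℝ}
    (hlim : ∀ᵐ ω ∂P, Tendsto (fun n => (a n)⁻¹ • ∑ i ∈ Finset.range n, f (X i ω)) atTop (𝓝 0)) :
    ∀ᵐ ω ∂P, Tendsto (fun n => (a n)⁻¹ • ∑ i ∈ Finset.range n, d i (X i ω) • f (X i ω))
      atTop (𝓝 0) := by
  have key := ae_tendsto_zero_of_measure_window_le (P := P)
    (G := fun n ω => ‖(a n)⁻¹ • ∑ i ∈ Finset.range n, f (X i ω)‖)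
    (H := fun n ω => ‖(a n)⁻¹ • ∑ i ∈ Finset.range n, d i (X i ω) • f (X i ω)‖)
    (fun n => ((Finset.measurable_fun_sum _ fun i _ => hf.comp (hX i)).const_smul _).norm)
    (fun _ _ => norm_nonneg _) ?_ ?_
  · filter_upwards [key] with ω hω
    exact tendsto_zero_iff_norm_tendsto_zero.2 hω
  · intro t ht m N
    let L : ℕ → (Fin N → B) → B := fun n z => (a n)⁻¹ • ∑ i : Fin N with i.val < n, z i
    -- Leaving this convex set means that some normalized partial sum in the window exceeds `t`.
    let K : Set (Fin N → B) := {z | ∀ n, m ≤ n → n ≤ N → ‖L n z‖ ≤ t}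
    have hKm : MeasurableSet K := by
      have : K = ⋂ n, ⋂ (_ : m ≤ n), ⋂ (_ : n ≤ N), {z | ‖L n z‖ ≤ t} := by
        ext z; simp [K]
      rw [this]
      refine .iInter fun n => .iInter fun _ => .iInter fun _ => measurableSet_le ?_ measurable_const
      exact ((Finset.measurable_fun_sum _ fun i _ => measurable_pi_apply i).const_smul _).norm
    have hK : Convex ℝ K := by
      intro x hx y hy α β hα hβ hαβ n h1 h2
      have : L n (α • x + β • y) = α • L n x + β • L n y := by
        simp only [L, Pi.add_apply, Pi.smul_apply, Finset.sum_add_distrib, ← Finset.smul_sum,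
          smul_add]
        rw [smul_comm α, smul_comm β]
      rw [this]
      calc ‖α • L n x + β • L n y‖ ≤ ‖α • L n x‖ + ‖β • L n y‖ := norm_add_le _ _
        _ = α * ‖L n x‖ + β * ‖L n y‖ := by
          rw [norm_smul α, norm_smul β, Real.norm_of_nonneg hα, Real.norm_of_nonneg hβ]
        _ ≤ α * t + β * t := by
          gcongr
          · exact hx n h1 h2
          · exact hy n h1 h2
        _ = t := by rw [← add_mul, hαβ, one_mul]
    have hset : ∀ z : ℕ → B, (fun i : Fin N => z i) ∉ K ↔
        ∃ n, m ≤ n ∧ n ≤ N ∧ t < ‖(a n)⁻¹ • ∑ i ∈ Finset.range n, z i‖ := by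
      intro z
      have hL : ∀ n ≤ N, L n (fun i : Fin N => z i) = (a n)⁻¹ • ∑ i ∈ Finset.range n, z i := by
        intro n hn
        simp only [L]
        congr 1
        rw [Finset.sum_filter, Fin.sum_univ_eq_sum_range (fun i => if i < n then z i else 0),
          ← Finset.sum_filter]
        congr 1
        ext i
        simp only [Finset.mem_range, Finset.mem_filter]
        omega
      simp only [K, Set.mem_ofPred_eq, not_forall, not_le]
      constructor
      · rintro ⟨n, h1, h2, h3⟩
        exact ⟨n, h1, h2, by rwa [hL n h2] at h3⟩
      · rintro ⟨n, h1, h2, h3⟩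
        exact ⟨n, h1, h2, by rwa [hL n h2]⟩
    have h := measure_contraction_notMem_le hX hind hsymm hf hodd hd heven hd0 hd1 N hK hKm
    have e1 : ∀ ω, (fun i : Fin N => d i (X i ω) • f (X i ω)) ∉ K ↔ _ :=
      fun ω => hset (fun i => d i (X i ω) • f (X i ω))
    have e2 : ∀ ω, (fun i : Fin N => f (X i ω)) ∉ K ↔ _ := fun ω => hset (fun i => f (X i ω))
    simp_rw [e1, e2] at h
    exact h
  · filter_upwards [hlim] with ω hω
    exact tendsto_zero_iff_norm_tendsto_zero.1 hω

end Contraction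

/-! ### Deterministic summation lemmas and the scaling function. -/

section Deterministic

variable {B : Type*} [NormedAddCommGroup B] [NormedSpace ℝ B]

/-- `C` absorbs the finitely many initial terms. A bound valid for every `n ≥ 1` controls maxima
over all earlier partial sums when the norming is monotone. -/
lemma exists_norm_le_add_mul {a : ℕ → ℝ} (ha : ∀ n, 1 ≤ n → 0 < a n) {T : ℕ → B}
    (hT : Tendsto (fun n => (a n)⁻¹ • T n) atTop (𝓝 0)) {ε : ℝ} (hε : 0 < ε) :
    ∃ C, 0 ≤ C ∧ ∀ n, 1 ≤ n → ‖T n‖ ≤ C + ε * a n := by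
  obtain ⟨m, hm⟩ := eventually_atTop.1
    ((tendsto_zero_iff_norm_tendsto_zero.1 hT).eventually (gt_mem_nhds hε))
  refine ⟨∑ k ∈ Finset.range m, ‖T k‖, Finset.sum_nonneg fun _ _ => norm_nonneg _, fun n hn => ?_⟩
  have han := ha n hn
  by_cases h : n < m
  · have h1 : ‖T n‖ ≤ ∑ k ∈ Finset.range m, ‖T k‖ :=
      Finset.single_le_sum (f := fun k => ‖T k‖) (fun _ _ => norm_nonneg _) (Finset.mem_range.2 h)
    have : 0 ≤ ε * a n := by positivity
    linarith
  · have h1 := hm n (not_lt.1 h)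
    rw [norm_smul, norm_inv, Real.norm_of_nonneg han.le, inv_mul_lt_iff₀ han] at h1
    have : 0 ≤ ∑ k ∈ Finset.range m, ‖T k‖ := Finset.sum_nonneg fun _ _ => norm_nonneg _
    linarith

/-- If the partial sums of `x` are `o(a n)` and `b / a` is nondecreasing, then the partial sums of
`(b / a) x` are `o(b n)`. -/
lemma tendsto_inv_smul_sum_ratio_smul {a b : ℕ → ℝ}
    (ha_pos : ∀ n, 1 ≤ n → 0 < a n) (hb_pos : ∀ n, 1 ≤ n → 0 < b n)
    (ha_mono : MonotoneOn a (Set.Ici 1)) (ha_top : Tendsto a atTop atTop)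
    (hba_mono : MonotoneOn (fun n => b n / a n) (Set.Ici 1)) {x : ℕ → B}
    (hx : Tendsto (fun n => (a n)⁻¹ • ∑ i ∈ Finset.range n, x i) atTop (𝓝 0)) :
    Tendsto (fun n => (b n)⁻¹ • ∑ i ∈ Finset.range n, (b (i + 1) / a (i + 1)) • x i)
      atTop (𝓝 0) := by
  have hw : ∀ i, b (i + 1) / a (i + 1) ≤ b (i + 2) / a (i + 2) := fun i =>
    hba_mono (by simp) (by simp) (by omega)
  have bound : ∀ ε > 0, ∃ C, ∀ n, 1 ≤ n →
      ‖(b n)⁻¹ • ∑ i ∈ Finset.range n, (b (i + 1) / a (i + 1)) • x i‖ ≤ 2 * (C * (a n)⁻¹ + ε) := by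
    intro ε hε
    obtain ⟨C, hC, hT⟩ := exists_norm_le_add_mul ha_pos hx hε
    refine ⟨C, fun n hn => ?_⟩
    obtain ⟨m, rfl⟩ : ∃ m, n = m + 1 := ⟨n - 1, by omega⟩
    have ham := ha_pos (m + 1) hn
    have hbm := hb_pos (m + 1) hn
    have hwm : 0 < b (m + 1) / a (m + 1) := by positivity
    set M := C + ε * a (m + 1) with hM
    have hM0 : 0 ≤ M := by positivity
    have hTM : ∀ k, 1 ≤ k → k ≤ m + 1 → ‖∑ i ∈ Finset.range k, x i‖ ≤ M := by
      intro k h1 h2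
      refine (hT k h1).trans ?_
      have := ha_mono (Set.mem_Ici.2 h1) (Set.mem_Ici.2 hn) h2
      rw [hM]
      gcongr
    -- The increments of `b / a` are nonnegative, so the boundary term and the telescoping sum are
    -- each at most `(b / a) * M`. Dividing by `b` leaves `2 * M / a`.
    rw [Finset.sum_range_by_parts, norm_smul, norm_inv, Real.norm_of_nonneg hbm.le,
      inv_mul_le_iff₀ hbm]
    simp only [Nat.add_sub_cancel]
    have h1 : ‖∑ i ∈ Finset.range m, (b (i + 1 + 1) / a (i + 1 + 1) - b (i + 1) / a (i + 1)) •
        ∑ i ∈ Finset.range (i + 1), x i‖ ≤ (b (m + 1) / a (m + 1)) * M := by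
      calc _ ≤ ∑ i ∈ Finset.range m, (b (i + 1 + 1) / a (i + 1 + 1) - b (i + 1) / a (i + 1)) * M := by
            refine norm_sum_le_of_le _ fun i hi => ?_
            have hi := Finset.mem_range.1 hi
            have h0 : 0 ≤ b (i + 1 + 1) / a (i + 1 + 1) - b (i + 1) / a (i + 1) :=
              sub_nonneg.2 (hw i)
            rw [norm_smul, Real.norm_of_nonneg h0]
            exact mul_le_mul_of_nonneg_left (hTM _ (by omega) (by omega)) h0
        _ = (b (m + 1) / a (m + 1) - b 1 / a 1) * M := by
            rw [← Finset.sum_mul, Finset.sum_range_sub (fun i => b (i + 1) / a (i + 1))]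
        _ ≤ _ := by
            have : 0 < b 1 / a 1 := div_pos (hb_pos 1 le_rfl) (ha_pos 1 le_rfl)
            gcongr
            linarith
    have h2 : ‖(b (m + 1) / a (m + 1)) • ∑ i ∈ Finset.range (m + 1), x i‖
        ≤ (b (m + 1) / a (m + 1)) * M := by
      rw [norm_smul, Real.norm_of_nonneg hwm.le]
      exact mul_le_mul_of_nonneg_left (hTM _ hn le_rfl) hwm.le
    refine (norm_sub_le _ _).trans ((add_le_add h2 h1).trans (le_of_eq ?_))
    rw [hM]
    field_simp
    ring
  rw [tendsto_zero_iff_norm_tendsto_zero, Metric.tendsto_atTop']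
  intro ε hε
  obtain ⟨C, hC⟩ := bound (ε / 4) (by positivity)
  have hlim : Tendsto (fun n => 2 * (C * (a n)⁻¹ + ε / 4)) atTop (𝓝 (2 * (C * 0 + ε / 4))) :=
    (((tendsto_inv_atTop_zero.comp ha_top).const_mul C).add_const _).const_mul 2
  have hev := hlim.eventually (gt_mem_nhds (show 2 * (C * 0 + ε / 4) < ε by linarith))
  obtain ⟨m, hm⟩ := eventually_atTop.1 (hev.and (eventually_ge_atTop 1))
  refine ⟨m, fun n hn => ?_⟩
  obtain ⟨h1, h2⟩ := hm n hn.le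
  rw [Real.dist_eq, sub_zero, abs_of_nonneg (norm_nonneg _)]
  exact (hC n h2).trans_lt h1

lemma tendsto_inv_smul_sum_of_eventually_eq {c : ℕ → ℝ} (hc : Tendsto c atTop atTop)
    {x y : ℕ → B} (hxy : ∀ᶠ i in atTop, x i = y i)
    (hx : Tendsto (fun n => (c n)⁻¹ • ∑ i ∈ Finset.range n, x i) atTop (𝓝 0)) :
    Tendsto (fun n => (c n)⁻¹ • ∑ i ∈ Finset.range n, y i) atTop (𝓝 0) := by
  obtain ⟨m, hm⟩ := eventually_atTop.1 hxy
  have h1 : Tendsto (fun n => (c n)⁻¹ • ∑ i ∈ Finset.range m, (y i - x i)) atTop (𝓝 0) := by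
    have := (tendsto_inv_atTop_zero.comp hc).smul_const (∑ i ∈ Finset.range m, (y i - x i))
    simpa using this
  have h2 := hx.add h1
  rw [add_zero] at h2
  refine h2.congr' ?_
  filter_upwards [eventually_ge_atTop m] with n hn
  rw [← smul_add]
  congr 1
  have : ∑ i ∈ Finset.range m, (y i - x i) = ∑ i ∈ Finset.range n, (y i - x i) := by
    refine Finset.sum_subset (Finset.range_mono hn) fun i _ hi => ?_
    rw [hm i (by simpa using hi), sub_self]
  rw [this, Finset.sum_sub_distrib]
  abel

/-- A scaling function: `W r` is the value of `b / a` at the first index where `b`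
reaches `r`. -/
lemma exists_ratio_function {a b : ℕ → ℝ}
    (ha_pos : ∀ n, 1 ≤ n → 0 < a n) (hb_pos : ∀ n, 1 ≤ n → 0 < b n)
    (ha_mono : MonotoneOn a (Set.Ici 1)) (hb_top : Tendsto b atTop atTop)
    (hba_mono : MonotoneOn (fun n => b n / a n) (Set.Ici 1)) :
    ∃ W : ℝ → ℝ, Monotone W ∧ (∀ r, 0 < W r) ∧ (∀ n, 1 ≤ n → ∀ r ≤ b n, W r ≤ b n / a n) ∧
      ∀ n, 1 ≤ n → ∀ r ≤ b n, r ≤ a n * W r := by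
  classical
  have hex : ∀ r : ℝ, ∃ k, 1 ≤ k ∧ r ≤ b k := fun r =>
    ((eventually_ge_atTop 1).and (hb_top.eventually_ge_atTop r)).exists
  have hmin : ∀ r n, 1 ≤ n → r ≤ b n → Nat.find (hex r) ≤ n := fun r n h1 h2 =>
    Nat.find_min' (hex r) ⟨h1, h2⟩
  have hone : ∀ r, 1 ≤ Nat.find (hex r) := fun r => (Nat.find_spec (hex r)).1
  have hle : ∀ r, r ≤ b (Nat.find (hex r)) := fun r => (Nat.find_spec (hex r)).2
  refine ⟨fun r => b (Nat.find (hex r)) / a (Nat.find (hex r)), ?_, ?_, ?_, ?_⟩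
  · intro r r' h
    exact hba_mono (hone r) (hone r') (hmin r _ (hone r') (h.trans (hle r')))
  · exact fun r => div_pos (hb_pos _ (hone r)) (ha_pos _ (hone r))
  · exact fun n hn r hr => hba_mono (hone r) hn (hmin r n hn hr)
  · intro n hn r hr
    have h1 := ha_mono (hone r) hn (hmin r n hn hr)
    have h2 := ha_pos _ (hone r)
    have h3 := hb_pos _ (hone r)
    calc r ≤ b (Nat.find (hex r)) := hle r
      _ = a (Nat.find (hex r)) * (b (Nat.find (hex r)) / a (Nat.find (hex r))) := by field_simp
      _ ≤ _ := by gcongr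

lemma tendsto_atTop_of_ratio_monotoneOn {a b : ℕ → ℝ}
    (ha_pos : ∀ n, 1 ≤ n → 0 < a n) (hb_pos : ∀ n, 1 ≤ n → 0 < b n)
    (ha_top : Tendsto a atTop atTop)
    (hba_mono : MonotoneOn (fun n => b n / a n) (Set.Ici 1)) : Tendsto b atTop atTop := by
  have h1 : 0 < b 1 / a 1 := div_pos (hb_pos 1 le_rfl) (ha_pos 1 le_rfl)
  refine tendsto_atTop_mono' atTop ?_ (ha_top.const_mul_atTop h1)
  filter_upwards [eventually_ge_atTop 1] with n hn
  have := hba_mono (Set.mem_Ici.2 le_rfl) (Set.mem_Ici.2 hn) hn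
  exact (le_div_iff₀ (ha_pos n hn)).1 this

end Deterministic

/-! ### The symmetric strong law with norming `b`. -/

section SymmetricCase

lemma IsIID.comp {Ω β β' : Type*} [MeasurableSpace Ω] {P : Measure Ω} [MeasurableSpace β]
    [MeasurableSpace β'] {X : ℕ → Ω → β} (hX : IsIID P X) {g : β → β'} (hg : Measurable g) :
    IsIID P (fun i ω => g (X i ω)) :=
  ⟨fun i => hg.comp (hX.measurable i), hX.indep.comp (fun _ => g) (fun _ => hg),
    fun i => (hX.identDistrib i).comp hg⟩

variable {B : Type u} [NormedAddCommGroup B] [NormedSpace ℝ B] [MeasurableSpace B] [BorelSpace B]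
variable {Ω : Type v} [MeasurableSpace Ω] {P : Measure Ω}

/-- The symmetric strong law transfers to probability spaces in any universe. -/
lemma SymmetricSLLN.ae_tendsto {a : ℕ → ℝ} (hsym : SymmetricSLLN B a) [IsProbabilityMeasure P]
    {X : ℕ → Ω → B} (hX : IsIID P X) (hs : IsSymmetric P (X 0)) (ht : tailSeries P (X 0) a < ∞) :
    ∀ᵐ ω ∂P, Tendsto (fun n : ℕ => (a n)⁻¹ • partialSum X n ω) atTop (𝓝 0) := by
  -- The sequence is replaced by the coordinate process on `ℕ → B`, a space in the universe of `B`,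
  -- under the joint law.
  have hm : Measurable fun ω i => X i ω := measurable_pi_lambda _ hX.measurable
  have := Measure.isProbabilityMeasure_map (μ := P) hm.aemeasurable
  have hmap : ∀ i, (P.map fun ω i => X i ω).map (fun x : ℕ → B => x i) = P.map (X i) := fun i => by
    rw [Measure.map_map (measurable_pi_apply i) hm]
    rfl
  have hiid : IsIID (P.map fun ω i => X i ω) (fun i (x : ℕ → B) => x i) := by
    refine ⟨measurable_pi_apply, ?_, fun i =>
      ⟨(measurable_pi_apply i).aemeasurable, (measurable_pi_apply 0).aemeasurable, ?_⟩⟩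
    · rw [iIndepFun_iff_map_fun_eq_infinitePi_map measurable_pi_apply]
      simp_rw [hmap]
      rw [← hX.indep.map_fun_eq_infinitePi_map hX.measurable]
      exact Measure.map_id
    · rw [hmap, hmap]
      exact (hX.identDistrib i).map_eq
  refine ae_of_ae_map hm.aemeasurable (hsym (ℕ → B) _ _ hiid ?_ ?_)
  · refine ⟨(measurable_pi_apply 0).aemeasurable, (measurable_pi_apply 0).fun_neg.aemeasurable, ?_⟩
    rw [hmap, Measure.map_map (measurable_pi_apply 0).fun_neg hm]
    exact hs.map_eq
  · refine lt_of_eq_of_lt ?_ ht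
    unfold tailSeries
    congr 1
    funext n
    rw [Measure.map_apply hm
      (measurableSet_lt measurable_const (measurable_pi_apply 0).norm)]
    rfl

omit [NormedSpace ℝ B] in
lemma IsIID.isSymmetric {X : ℕ → Ω → B} (hX : IsIID P X) (hs : IsSymmetric P (X 0)) (i : ℕ) :
    IsSymmetric P (X i) :=
  ((hX.identDistrib i).trans hs).trans ((hX.identDistrib i).comp measurable_neg).symm

omit [NormedSpace ℝ B] in
/-- First Borel–Cantelli lemma for an i.i.d. sequence. -/
lemma IsIID.ae_eventually_norm_le {X : ℕ → Ω → B} (hX : IsIID P X) {c : ℕ → ℝ}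
    (ht : tailSeries P (X 0) c < ∞) : ∀ᵐ ω ∂P, ∀ᶠ i in atTop, ‖X i ω‖ ≤ c (i + 1) := by
  have h : ∑' i, P {ω | c (i + 1) < ‖X i ω‖} ≠ ∞ := by
    refine ne_of_lt (lt_of_eq_of_lt ?_ ht)
    unfold tailSeries
    congr 1
    funext i
    exact (hX.identDistrib i).measure_mem_eq (s := {x | c (i + 1) < ‖x‖})
      (measurableSet_lt measurable_const measurable_norm)
  filter_upwards [ae_eventually_notMem h] with ω hω
  filter_upwards [hω] with i hi
  exact not_lt.1 hi

/-- The strong law for symmetric sequences passes from the norming sequence `a` to `b`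
whenever `b / a` is nondecreasing. -/
lemma SymmetricSLLN.ae_tendsto_of_ratio [SecondCountableTopology B] [IsProbabilityMeasure P]
    {a b : ℕ → ℝ} (ha_pos : ∀ n, 1 ≤ n → 0 < a n) (hb_pos : ∀ n, 1 ≤ n → 0 < b n)
    (ha_mono : MonotoneOn a (Set.Ici 1)) (ha_top : Tendsto a atTop atTop)
    (hba_mono : MonotoneOn (fun n => b n / a n) (Set.Ici 1)) (hsym : SymmetricSLLN B a)
    {X : ℕ → Ω → B} (hX : IsIID P X) (hs : IsSymmetric P (X 0)) (ht : tailSeries P (X 0) b < ∞) :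
    ∀ᵐ ω ∂P, Tendsto (fun n : ℕ => (b n)⁻¹ • partialSum X n ω) atTop (𝓝 0) := by
  have hb_top := tendsto_atTop_of_ratio_monotoneOn ha_pos hb_pos ha_top hba_mono
  obtain ⟨W, hWm, hW0, hW1, hW2⟩ :=
    exists_ratio_function ha_pos hb_pos ha_mono hb_top hba_mono
  -- The bound `r ≤ a n * W r` for `r ≤ b n` yields the tail condition for `f`. The bound `W r ≤ b n
  -- / a n` makes the cap in `d` inactive when `‖x‖ ≤ b (i + 1)`, and then `(b / a) • d • f` is the
  -- identity.
  let f : B → B := fun x => (W ‖x‖)⁻¹ • x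
  let d : ℕ → B → ℝ := fun i x => min 1 (W ‖x‖ / (b (i + 1) / a (i + 1)))
  have hWn : Measurable fun x : B => W ‖x‖ := hWm.measurable.comp measurable_norm
  have hf : Measurable f := hWn.inv.smul measurable_id
  have hodd : ∀ x, f (-x) = -f x := fun x => by simp [f]
  have hd : ∀ i, Measurable (d i) := fun i => measurable_const.min (hWn.div_const _)
  have hw0 : ∀ i, 0 < b (i + 1) / a (i + 1) := fun i =>
    div_pos (hb_pos _ (by omega)) (ha_pos _ (by omega))
  have hfX : IsIID P (fun i ω => f (X i ω)) := hX.comp hf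
  have hfs : IsSymmetric P (fun ω => f (X 0 ω)) := by
    have h := hs.comp hf
    have e : f ∘ (fun ω => -X 0 ω) = fun ω => -(f (X 0 ω)) := by
      funext ω
      exact hodd _
    rw [e] at h
    exact h
  have hft : tailSeries P (fun ω => f (X 0 ω)) a < ∞ := by
    refine lt_of_le_of_lt (ENNReal.tsum_le_tsum fun n => measure_mono fun ω hω => ?_) ht
    by_contra hcon
    have hr : ‖X 0 ω‖ ≤ b (n + 1) := not_lt.1 hcon
    have h1 := hW2 (n + 1) (by omega) _ hr
    have h2 : a (n + 1) < ‖f (X 0 ω)‖ := hω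
    simp only [f] at h2
    rw [norm_smul, norm_inv, Real.norm_of_nonneg (hW0 _).le, lt_inv_mul_iff₀ (hW0 _)] at h2
    linarith
  have hlim := hsym.ae_tendsto hfX hfs hft
  have hcontr := ae_tendsto_contraction hX.measurable hX.indep (hX.isSymmetric hs) hf hodd hd
    (fun i x => by simp [d]) (fun i x => le_min zero_le_one (div_pos (hW0 _) (hw0 i)).le)
    (fun i x => min_le_left _ _) hlim
  filter_upwards [hcontr, hX.ae_eventually_norm_le ht] with ω h1 h2
  refine tendsto_inv_smul_sum_of_eventually_eq hb_top ?_
    (tendsto_inv_smul_sum_ratio_smul ha_pos hb_pos ha_mono ha_top hba_mono h1)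
  filter_upwards [h2] with i hi
  have h3 := hW1 (i + 1) (by omega) _ hi
  have h4 := hW0 ‖X i ω‖
  have h5 := hw0 i
  have hdi : d i (X i ω) = W ‖X i ω‖ / (b (i + 1) / a (i + 1)) :=
    min_eq_right ((div_le_one h5).2 h3)
  rw [hdi]
  simp only [f]
  rw [smul_smul, smul_smul, mul_div_cancel₀ _ h5.ne', mul_inv_cancel₀ h4.ne', one_smul]

end SymmetricCase

/-! ### Two independent copies. -/

section ProductSpace

variable {Ω β : Type*} [MeasurableSpace Ω] [MeasurableSpace β] {P : Measure Ω}

/-- An i.i.d. sequence paired with an independent copy of itself is i.i.d. -/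
lemma IsIID.prodMk [IsProbabilityMeasure P] {X : ℕ → Ω → β} (hX : IsIID P X) :
    IsIID (P.prod P) (fun i (p : Ω × Ω) => (X i p.1, X i p.2)) := by
  have hm : ∀ i, Measurable fun p : Ω × Ω => (X i p.1, X i p.2) := fun i =>
    ((hX.measurable i).comp measurable_fst).prodMk ((hX.measurable i).comp measurable_snd)
  refine ⟨hm, ?_, fun i => ⟨(hm i).aemeasurable, (hm 0).aemeasurable, ?_⟩⟩
  · rw [iIndepFun_iff_measure_inter_preimage_eq_mul]
    intro S sets hsets
    classical
    -- Extending by `Set.univ` outside `S` makes the slice functions `g i` measurable for every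
    -- index.
    let A : ℕ → Set (β × β) := fun i => if i ∈ S then sets i else Set.univ
    have hA : ∀ i, MeasurableSet (A i) := by
      intro i
      by_cases hi : i ∈ S
      · simpa [A, hi] using hsets i hi
      · simp [A, hi]
    have hAS : ∀ i ∈ S, sets i = A i := fun i hi => by simp [A, hi]
    rw [Set.iInter₂_congr fun i hi => by rw [hAS i hi], Finset.prod_congr rfl fun i hi => by
      rw [hAS i hi]]
    let g : ℕ → β → ℝ≥0∞ := fun i x => P {ω | (x, X i ω) ∈ A i}
    have hg : ∀ i, Measurable (g i) := by
      intro i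
      have : MeasurableSet {q : β × Ω | (q.1, X i q.2) ∈ A i} :=
        (measurable_fst.prodMk ((hX.measurable i).comp measurable_snd)) (hA i)
      exact measurable_measure_prodMk_left this
    have h1 : ∀ i, (P.prod P) ((fun p : Ω × Ω => (X i p.1, X i p.2)) ⁻¹' A i)
        = ∫⁻ ω, g i (X i ω) ∂P := by
      intro i
      rw [Measure.prod_apply (hm i (hA i))]
      rfl
    simp_rw [h1]
    -- Independence in the first copy merges the product of integrals into one integral.
    -- Independence in the second copy factors each slice.
    rw [← lintegral_prod_eq_prod_lintegral_of_indepFun S (fun i ω => g i (X i ω))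
      (hX.indep.comp g hg) (fun i => (hg i).comp (hX.measurable i)),
      Measure.prod_apply (Finset.measurableSet_biInter S fun i _ => hm i (hA i))]
    refine lintegral_congr fun ω => ?_
    have hsl : ∀ i ∈ S, MeasurableSet {y : β | (X i ω, y) ∈ A i} := fun i _ =>
      measurable_prodMk_left (hA i)
    have h2 := hX.indep.measure_inter_preimage_eq_mul S hsl
    have h3 : Prod.mk ω ⁻¹' (⋂ i ∈ S, (fun p : Ω × Ω => (X i p.1, X i p.2)) ⁻¹' A i)
        = ⋂ i ∈ S, X i ⁻¹' {y : β | (X i ω, y) ∈ A i} := by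
      ext ω'
      simp
    rw [h3, h2]
    rfl
  · have h : ∀ j, (P.prod P).map (fun p : Ω × Ω => (X j p.1, X j p.2))
        = (P.map (X j)).prod (P.map (X j)) := fun j =>
      (Measure.map_prod_map P P (hX.measurable j) (hX.measurable j)).symm
    rw [h, h, (hX.identDistrib i).map_eq]

end ProductSpace

/-! ### From maximal probabilities to mean norms. -/

section Expectation

variable {Ω : Type*} [MeasurableSpace Ω] {P : Measure Ω} [IsProbabilityMeasure P]
variable {B : Type*} [NormedAddCommGroup B] [NormedSpace ℝ B] [CompleteSpace B]
  [MeasurableSpace B] [BorelSpace B] [SecondCountableTopology B]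

/-- Adding an independent centered vector does not decrease the mean norm. -/
lemma integral_norm_le_integral_norm_add {X Y : Ω → B} (hX : Measurable X) (hY : Measurable Y)
    (hXi : Integrable X P) (hYi : Integrable Y P) (hind : IndepFun X Y P) (hY0 : ∫ ω, Y ω ∂P = 0) :
    ∫ ω, ‖X ω‖ ∂P ≤ ∫ ω, ‖X ω + Y ω‖ ∂P := by
  have hlaw := (indepFun_iff_map_prod_eq_prod_map_map hX.aemeasurable hY.aemeasurable).1 hind
  have := Measure.isProbabilityMeasure_map (μ := P) hX.aemeasurable
  have := Measure.isProbabilityMeasure_map (μ := P) hY.aemeasurable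
  have hXl : Integrable (fun x : B => x) (P.map X) :=
    (integrable_map_measure aestronglyMeasurable_id hX.aemeasurable).2 hXi
  have hYl : Integrable (fun y : B => y) (P.map Y) :=
    (integrable_map_measure aestronglyMeasurable_id hY.aemeasurable).2 hYi
  have hYl0 : ∫ y, y ∂(P.map Y) = 0 := by
    exact (integral_map hY.aemeasurable aestronglyMeasurable_id).trans hY0
  have hm : Measurable fun q : B × B => ‖q.1 + q.2‖ := (measurable_fst.add measurable_snd).norm
  have hi : Integrable (fun q : B × B => ‖q.1 + q.2‖) ((P.map X).prod (P.map Y)) := by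
    rw [← hlaw, integrable_map_measure hm.aestronglyMeasurable (hX.prodMk hY).aemeasurable]
    exact (hXi.add hYi).norm
  have h1 : ∫ ω, ‖X ω + Y ω‖ ∂P = ∫ x, ∫ y, ‖x + y‖ ∂(P.map Y) ∂(P.map X) := by
    rw [← integral_prod (fun q : B × B => ‖q.1 + q.2‖) hi, ← hlaw,
      integral_map (hX.prodMk hY).aemeasurable hm.aestronglyMeasurable]
  have h2 : ∫ ω, ‖X ω‖ ∂P = ∫ x, ‖x‖ ∂(P.map X) := by
    rw [integral_map hX.aemeasurable measurable_norm.aestronglyMeasurable]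
  rw [h1, h2]
  refine integral_mono hXl.norm hi.integral_prod_left fun x => ?_
  -- Jensen's inequality for fixed `x`: since `Y` is centered, `x` is the mean of `x + Y`.
  calc ‖x‖ = ‖∫ y, (x + y) ∂(P.map Y)‖ := by
        rw [integral_add (integrable_const x) hYl, hYl0, integral_const]
        simp
    _ ≤ _ := norm_integral_le_integral_norm _

/-- For bounded independent centered vectors, the mean norm of the last partial sum is controlled by
the probability that some partial sum is large. -/
lemma integral_norm_partialSum_le {W : ℕ → Ω → B} (hW : ∀ i, Measurable (W i))
    (hind : iIndepFun W P) {c t : ℝ} (ht : 0 ≤ t) (hc : ∀ i ω, ‖W i ω‖ ≤ c)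
    (hW0 : ∀ i, ∫ ω, W i ω ∂P = 0) (n : ℕ) :
    ∫ ω, ‖partialSum W n ω‖ ∂P ≤
      t + P.real {ω | ∃ k ≤ n, t < ‖partialSum W k ω‖} *
        (t + c + ∫ ω, ‖partialSum W n ω‖ ∂P) := by
  have hWi : ∀ i, Integrable (W i) P := fun i =>
    Integrable.of_bound (hW i).aestronglyMeasurable c (ae_of_all _ (hc i))
  have hV : ∀ k, Measurable (partialSum W k) := fun k =>
    Finset.measurable_fun_sum _ fun i _ => hW i
  have hVi : ∀ k, Integrable (partialSum W k) P := fun k =>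
    integrable_finsetSum _ fun i _ => hWi i
  have hV0 : ∀ k, ∫ ω, partialSum W k ω ∂P = 0 := fun k => by
    simp only [partialSum]
    rw [integral_finsetSum _ fun i _ => hWi i]
    simp [hW0]
  let m : ℕ → MeasurableSpace Ω := fun i => MeasurableSpace.comap (W i) inferInstance
  have hmle : ∀ i, m i ≤ ‹MeasurableSpace Ω› := fun i => (hW i).comap_le
  let past : ℕ → MeasurableSpace Ω := fun k => ⨆ i ∈ {i | i < k}, m i
  let fut : ℕ → MeasurableSpace Ω := fun k => ⨆ i ∈ {i | k ≤ i}, m i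
  have hpf : ∀ k, Indep (past k) (fut k) P := fun k =>
    indep_iSup_of_disjoint hmle hind
      (Set.disjoint_left.2 fun i h1 h2 => absurd (show i < k from h1) (not_lt.2 h2))
  have hWm : ∀ (i : ℕ) (S : Set ℕ), i ∈ S → Measurable[⨆ i ∈ S, m i] (W i) := fun i S hi =>
    Measurable.mono (comap_measurable (W i)) (le_biSup m hi) le_rfl
  have hVp : ∀ k, ∀ j ≤ k, Measurable[past k] (partialSum W j) := by
    intro k j hj
    exact @Finset.measurable_fun_sum _ _ _ _ _ _ (past k) _ _ fun i hi =>
      hWm i {i | i < k} (lt_of_lt_of_le (Finset.mem_range.1 hi) hj)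
  have hdiff : ∀ k ≤ n, ∀ ω, partialSum W n ω - partialSum W k ω = ∑ i ∈ Finset.Ico k n, W i ω :=
    fun k hk ω => (Finset.sum_Ico_eq_sub _ hk).symm
  have hVf : ∀ k ≤ n, Measurable[fut k] fun ω => partialSum W n ω - partialSum W k ω := by
    intro k hk
    simp_rw [hdiff k hk]
    exact @Finset.measurable_fun_sum _ _ _ _ _ _ (fut k) _ _ fun i hi =>
      hWm i {i | k ≤ i} (Finset.mem_Ico.1 hi).1
  have hDi : ∀ k, Integrable (fun ω => partialSum W n ω - partialSum W k ω) P := fun k =>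
    (hVi n).sub (hVi k)
  -- The full sum is the remainder plus an independent centered vector, so the remainder has the
  -- smaller mean norm.
  have hDle : ∀ k ≤ n, ∫ ω, ‖partialSum W n ω - partialSum W k ω‖ ∂P
      ≤ ∫ ω, ‖partialSum W n ω‖ ∂P := by
    intro k hk
    have hI : IndepFun (fun ω => partialSum W n ω - partialSum W k ω) (partialSum W k) P :=
      (indep_of_indep_of_le_left (indep_of_indep_of_le_right (hpf k) (hVf k hk).comap_le)
        (hVp k k le_rfl).comap_le).symm
    have := integral_norm_le_integral_norm_add ((hV n).sub (hV k)) (hV k) (hDi k) (hVi k) hI (hV0 k)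
    simpa using this
  -- First passage above level `t` at time `k`. This event depends on the past only, hence is
  -- independent of the remainder, and the overshoot is at most `c`.
  let A : ℕ → Set Ω := fun k => {ω | t < ‖partialSum W k ω‖ ∧ ∀ j < k, ‖partialSum W j ω‖ ≤ t}
  have hAp : ∀ k, MeasurableSet[past k] (A k) := by
    intro k
    have e : A k = {ω | t < ‖partialSum W k ω‖} ∩
        ⋂ j, ⋂ (_ : j < k), {ω | ‖partialSum W j ω‖ ≤ t} := by
      ext ω; simp [A]
    rw [e]
    let := past k
    exact MeasurableSet.inter (measurableSet_lt measurable_const (hVp k k le_rfl).norm)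
      (.iInter fun j => .iInter fun hj => measurableSet_le (hVp k j hj.le).norm measurable_const)
  have hA : ∀ k, MeasurableSet (A k) := fun k =>
    (iSup₂_le fun i _ => hmle i : past k ≤ ‹MeasurableSpace Ω›) _ (hAp k)
  have hgi : ∀ k, Integrable (fun ω => t + c + ‖partialSum W n ω - partialSum W k ω‖) P := fun k =>
    (integrable_const _).add (hDi k).norm
  have hpt : ∀ ω, ‖partialSum W n ω‖ ≤ t + ∑ k ∈ Finset.range (n + 1),
      (A k).indicator (fun ω => t + c + ‖partialSum W n ω - partialSum W k ω‖) ω := by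
    intro ω
    have hc0 : 0 ≤ c := (norm_nonneg _).trans (hc 0 ω)
    have hterm : ∀ k ∈ Finset.range (n + 1),
        0 ≤ (A k).indicator (fun ω => t + c + ‖partialSum W n ω - partialSum W k ω‖) ω :=
      fun k _ => Set.indicator_nonneg (fun ω _ => by positivity) ω
    by_cases h : ‖partialSum W n ω‖ ≤ t
    · have := Finset.sum_nonneg hterm
      linarith
    · have hex : ∃ k, t < ‖partialSum W k ω‖ := ⟨n, not_le.1 h⟩
      classical
      set k := Nat.find hex with hk
      have hkn : k ≤ n := Nat.find_min' hex (not_le.1 h)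
      have hkA : ω ∈ A k := ⟨Nat.find_spec hex, fun j hj => not_lt.1 (Nat.find_min hex hj)⟩
      have hVk : ‖partialSum W k ω‖ ≤ t + c := by
        rcases Nat.eq_zero_or_pos k with h0 | h0
        · rw [h0]
          simp only [partialSum, Finset.range_zero, Finset.sum_empty, norm_zero]
          positivity
        · obtain ⟨l, hl⟩ : ∃ l, k = l + 1 := ⟨k - 1, by omega⟩
          rw [hl]
          have h1 := hkA.2 l (by omega)
          have h2 := hc l ω
          calc ‖partialSum W (l + 1) ω‖ = ‖partialSum W l ω + W l ω‖ := by
                simp [partialSum, Finset.sum_range_succ]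
            _ ≤ ‖partialSum W l ω‖ + ‖W l ω‖ := norm_add_le _ _
            _ ≤ t + c := add_le_add h1 h2
      have h1 := Finset.single_le_sum hterm (Finset.mem_range.2 (Nat.lt_succ_of_le hkn))
      rw [Set.indicator_of_mem hkA] at h1
      have h2 : ‖partialSum W n ω‖ ≤ ‖partialSum W k ω‖ + ‖partialSum W n ω - partialSum W k ω‖ := by
        have := norm_add_le (partialSum W k ω) (partialSum W n ω - partialSum W k ω)
        simpa using this
      linarith
  have hint : ∀ k ≤ n, ∫ ω, (A k).indicator
      (fun ω => t + c + ‖partialSum W n ω - partialSum W k ω‖) ω ∂P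
      ≤ P.real (A k) * (t + c + ∫ ω, ‖partialSum W n ω‖ ∂P) := by
    intro k hk
    have hI : IndepFun ((A k).indicator (fun _ => (1 : ℝ)))
        (fun ω => t + c + ‖partialSum W n ω - partialSum W k ω‖) P := by
      have h1 : Measurable[past k] ((A k).indicator (fun _ => (1 : ℝ))) :=
        measurable_const.indicator (hAp k)
      have h2 : Measurable[fut k] (fun ω => t + c + ‖partialSum W n ω - partialSum W k ω‖) :=
        (measurable_const_add (t + c)).comp (measurable_norm.comp (hVf k hk))
      exact indep_of_indep_of_le_left (indep_of_indep_of_le_right (hpf k) h2.comap_le) h1.comap_le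
    have e : ∀ ω, (A k).indicator (fun ω => t + c + ‖partialSum W n ω - partialSum W k ω‖) ω
        = (A k).indicator (fun _ => (1 : ℝ)) ω *
          (t + c + ‖partialSum W n ω - partialSum W k ω‖) := by
      intro ω
      by_cases h : ω ∈ A k <;> simp [h]
    simp_rw [e]
    rw [hI.integral_fun_mul_eq_mul_integral
      (measurable_const.indicator (hA k)).aestronglyMeasurable (hgi k).aestronglyMeasurable,
      integral_indicator_const _ (hA k), integral_add (integrable_const _) (hDi k).norm]
    simp only [smul_eq_mul, mul_one, integral_const, probReal_univ, one_mul]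
    have := hDle k hk
    gcongr
  have hsum : ∑ k ∈ Finset.range (n + 1), P.real (A k)
      ≤ P.real {ω | ∃ k ≤ n, t < ‖partialSum W k ω‖} := by
    have hdisj : Set.PairwiseDisjoint (↑(Finset.range (n + 1))) A := by
      intro i _ j _ hij
      refine Set.disjoint_left.2 fun ω h1 h2 => ?_
      rcases lt_or_gt_of_ne hij with h | h
      · exact absurd h1.1 (not_lt.2 (h2.2 i h))
      · exact absurd h2.1 (not_lt.2 (h1.2 j h))
    rw [← measureReal_biUnion_finset hdisj fun k _ => hA k]
    refine measureReal_mono fun ω hω => ?_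
    simp only [Set.mem_iUnion, Finset.mem_range] at hω
    obtain ⟨k, hk, h⟩ := hω
    exact ⟨k, Nat.lt_succ_iff.1 hk, h.1⟩
  have hindi : ∀ k, Integrable
      ((A k).indicator (fun ω => t + c + ‖partialSum W n ω - partialSum W k ω‖)) P := fun k =>
    (hgi k).indicator (hA k)
  have hc0 : 0 ≤ c := by
    obtain ⟨ω⟩ : Nonempty Ω := nonempty_of_isProbabilityMeasure P
    exact (norm_nonneg _).trans (hc 0 ω)
  have hE0 : 0 ≤ ∫ ω, ‖partialSum W n ω‖ ∂P := integral_nonneg fun _ => norm_nonneg _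
  calc ∫ ω, ‖partialSum W n ω‖ ∂P
      ≤ ∫ ω, (t + ∑ k ∈ Finset.range (n + 1),
        (A k).indicator (fun ω => t + c + ‖partialSum W n ω - partialSum W k ω‖) ω) ∂P :=
        integral_mono (hVi n).norm
          ((integrable_const t).add (integrable_finsetSum _ fun k _ => hindi k)) hpt
    _ = t + ∑ k ∈ Finset.range (n + 1), ∫ ω,
        (A k).indicator (fun ω => t + c + ‖partialSum W n ω - partialSum W k ω‖) ω ∂P := by
        rw [integral_add (integrable_const t) (integrable_finsetSum _ fun k _ => hindi k),
          integral_finsetSum _ fun k _ => hindi k]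
        simp
    _ ≤ t + ∑ k ∈ Finset.range (n + 1),
        P.real (A k) * (t + c + ∫ ω, ‖partialSum W n ω‖ ∂P) := by
        gcongr with k hk
        exact hint k (Nat.lt_succ_iff.1 (Finset.mem_range.1 hk))
    _ ≤ _ := by
        rw [← Finset.sum_mul]
        gcongr

end Expectation

/-! ### Symmetrization and tail series. -/

section Symmetrization

variable {B : Type u} [NormedAddCommGroup B] [NormedSpace ℝ B] [MeasurableSpace B] [BorelSpace B]
  [SecondCountableTopology B]
variable {Ω : Type v} [MeasurableSpace Ω] {P : Measure Ω} [IsProbabilityMeasure P]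

omit [NormedSpace ℝ B] [SecondCountableTopology B] in
/-- Second Borel–Cantelli lemma for an i.i.d. sequence. -/
lemma IsIID.tailSeries_lt_top {X : ℕ → Ω → B} (hX : IsIID P X) {c : ℕ → ℝ}
    (h : P {ω | ∀ᶠ i in atTop, ‖X i ω‖ ≤ c (i + 1)} ≠ 0) : tailSeries P (X 0) c < ∞ := by
  by_contra hcon
  have htop : tailSeries P (X 0) c = ∞ := not_lt_top_iff.1 hcon
  let s : ℕ → Set Ω := fun i => X i ⁻¹' {x | c (i + 1) < ‖x‖}
  have hset : ∀ i, MeasurableSet {x : B | c (i + 1) < ‖x‖} := fun i =>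
    measurableSet_lt measurable_const measurable_norm
  have hs : ∀ i, MeasurableSet (s i) := fun i => hX.measurable i (hset i)
  have hind : iIndepSet s P := (iIndepSet_iff_meas_biInter hs).2 fun S =>
    hX.indep.measure_inter_preimage_eq_mul S fun i _ => hset i
  have hsum : ∑' i, P (s i) = ∞ := by
    rw [← htop]
    unfold tailSeries
    congr 1
    funext i
    exact (hX.identDistrib i).measure_mem_eq (hset i)
  have hone := measure_limsup_eq_one hs hind hsum
  apply h
  have hae : ∀ᵐ ω ∂P, ω ∈ limsup s atTop := by
    rw [← prob_compl_eq_zero_iff (MeasurableSet.measurableSet_limsup hs)] at hone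
    exact hone
  refine measure_mono_null (fun ω hω => ?_) hae
  change ¬ (ω ∈ limsup s atTop)
  rw [Filter.mem_limsup_iff_frequently_mem, not_frequently]
  filter_upwards [show ∀ᶠ i in atTop, ‖X i ω‖ ≤ c (i + 1) from hω] with i hi
  exact not_lt.2 hi

omit [NormedSpace ℝ B] in
lemma IsIID.symmetrize {X : ℕ → Ω → B} (hX : IsIID P X) :
    IsIID (P.prod P) (fun i (p : Ω × Ω) => X i p.1 - X i p.2) :=
  hX.prodMk.comp (g := fun q : B × B => q.1 - q.2) (measurable_fst.sub measurable_snd)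

omit [NormedSpace ℝ B] in
lemma isSymmetric_sub_prod {Y : Ω → B} (hY : Measurable Y) :
    IsSymmetric (P.prod P) (fun p : Ω × Ω => Y p.1 - Y p.2) := by
  have hm : Measurable fun p : Ω × Ω => Y p.1 - Y p.2 :=
    (hY.comp measurable_fst).sub (hY.comp measurable_snd)
  refine ⟨hm.aemeasurable, hm.fun_neg.aemeasurable, ?_⟩
  conv_lhs => rw [← Measure.prod_swap (μ := P) (ν := P), Measure.map_map hm measurable_swap]
  congr 1
  funext p
  simp

omit [NormedSpace ℝ B] [MeasurableSpace B] [BorelSpace B] [SecondCountableTopology B] in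
lemma tailSeries_sub_prod_le {Y : Ω → B} (b : ℕ → ℝ) :
    tailSeries (P.prod P) (fun p : Ω × Ω => Y p.1 - Y p.2) (fun n => 2 * b n)
      ≤ 2 * tailSeries P Y b := by
  unfold tailSeries
  rw [← ENNReal.tsum_mul_left]
  refine ENNReal.tsum_le_tsum fun n => ?_
  set A := {ω | b (n + 1) < ‖Y ω‖} with hA
  have hsub : {p : Ω × Ω | 2 * b (n + 1) < ‖Y p.1 - Y p.2‖}
      ⊆ (A ×ˢ Set.univ) ∪ (Set.univ ×ˢ A) := by
    intro p hp
    by_contra hcon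
    simp only [hA, Set.mem_union, Set.mem_prod, Set.mem_univ, and_true, true_and,
      Set.mem_ofPred_eq, not_or, not_lt] at hcon
    have h1 : 2 * b (n + 1) < ‖Y p.1 - Y p.2‖ := hp
    have h2 := norm_sub_le (Y p.1) (Y p.2)
    linarith [hcon.1, hcon.2]
  calc _ ≤ (P.prod P) ((A ×ˢ Set.univ) ∪ (Set.univ ×ˢ A)) := measure_mono hsub
    _ ≤ (P.prod P) (A ×ˢ Set.univ) + (P.prod P) (Set.univ ×ˢ A) := measure_union_le _ _
    _ = 2 * P A := by simp [Measure.prod_prod, two_mul]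

omit [NormedSpace ℝ B] [MeasurableSpace B] [BorelSpace B] [SecondCountableTopology B] in
-- If `‖Y‖ ≤ m` has probability `q > 0`, then for `b ≥ 2 * m` a value above `b` in one copy and
-- below `m` in the other forces a difference above `b / 2`. Hence the tail of `Y` costs at most a
-- factor `q⁻¹`, apart from finitely many terms.
lemma tailSeries_lt_top_of_sub_prod {Y : Ω → B} {b : ℕ → ℝ} (hb : Tendsto b atTop atTop)
    (h : tailSeries (P.prod P) (fun p : Ω × Ω => Y p.1 - Y p.2) (fun n => 1 / 2 * b n) < ∞) :
    tailSeries P Y b < ∞ := by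
  obtain ⟨m, hm⟩ : ∃ m : ℕ, P {ω | ‖Y ω‖ ≤ m} ≠ 0 := by
    by_contra! hcon
    have hU : (⋃ m : ℕ, {ω | ‖Y ω‖ ≤ m}) = Set.univ := by
      refine Set.eq_univ_of_forall fun ω => Set.mem_iUnion.2 ?_
      exact exists_nat_ge ‖Y ω‖
    have h0 := measure_iUnion_null hcon
    rw [hU, measure_univ] at h0
    exact one_ne_zero h0
  set q := P {ω | ‖Y ω‖ ≤ m} with hq
  have hq' : q ≠ ∞ := measure_ne_top _ _
  obtain ⟨N, hN⟩ := eventually_atTop.1 (hb.eventually_ge_atTop (2 * (m : ℝ)))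
  have hterm : ∀ n, P {ω | b (n + 1) < ‖Y ω‖} ≤ (if n ∈ Finset.range N then 1 else 0) +
      q⁻¹ * (P.prod P) {p : Ω × Ω | 1 / 2 * b (n + 1) < ‖Y p.1 - Y p.2‖} := by
    intro n
    by_cases hn : n ∈ Finset.range N
    · rw [if_pos hn]
      exact le_add_right prob_le_one
    · rw [if_neg hn, zero_add]
      have hbn := hN (n + 1) (by simp at hn; omega)
      have hsub : {ω | b (n + 1) < ‖Y ω‖} ×ˢ {ω | ‖Y ω‖ ≤ m}
          ⊆ {p : Ω × Ω | 1 / 2 * b (n + 1) < ‖Y p.1 - Y p.2‖} := by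
        rintro p ⟨h1, h2⟩
        have h1 : b (n + 1) < ‖Y p.1‖ := h1
        have h2 : ‖Y p.2‖ ≤ m := h2
        have h3 := norm_sub_norm_le (Y p.1) (Y p.2)
        change 1 / 2 * b (n + 1) < ‖Y p.1 - Y p.2‖
        linarith
      have h4 := measure_mono (μ := P.prod P) hsub
      rw [Measure.prod_prod, ← hq] at h4
      rw [← ENNReal.div_eq_inv_mul, ENNReal.le_div_iff_mul_le (Or.inl hm) (Or.inl hq')]
      exact h4
  have hfin : ∑' n : ℕ, (if n ∈ Finset.range N then (1 : ℝ≥0∞) else 0) < ∞ := by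
    rw [tsum_eq_sum (s := Finset.range N) fun n hn => if_neg hn]
    exact ENNReal.sum_lt_top.2 fun n _ => by split_ifs <;> simp
  refine lt_of_le_of_lt (ENNReal.tsum_le_tsum hterm) ?_
  rw [ENNReal.tsum_add, ENNReal.tsum_mul_left]
  exact ENNReal.add_lt_top.2 ⟨hfin, ENNReal.mul_lt_top (ENNReal.inv_lt_top.2
    (pos_iff_ne_zero.2 hm)) h⟩

omit [NormedSpace ℝ B] [MeasurableSpace B] [BorelSpace B] [SecondCountableTopology B]
  [MeasurableSpace Ω] in
lemma partialSum_sub_prod (X : ℕ → Ω → B) (n : ℕ) (p : Ω × Ω) :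
    partialSum (fun i (p : Ω × Ω) => X i p.1 - X i p.2) n p
      = partialSum X n p.1 - partialSum X n p.2 := by
  simp [partialSum, Finset.sum_sub_distrib]

/-- The symmetrized partial sums obey the strong law with norming `b` as soon as the tail series
converges at some multiple of `b`. -/
lemma ae_tendsto_symmetrized
    {a b : ℕ → ℝ} (ha_pos : ∀ n, 1 ≤ n → 0 < a n) (hb_pos : ∀ n, 1 ≤ n → 0 < b n)
    (ha_mono : MonotoneOn a (Set.Ici 1)) (ha_top : Tendsto a atTop atTop)
    (hba_mono : MonotoneOn (fun n => b n / a n) (Set.Ici 1)) (hsym : SymmetricSLLN B a)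
    {X : ℕ → Ω → B} (hX : IsIID P X) {L : ℝ} (hL : 0 < L)
    (ht : tailSeries (P.prod P) (fun p : Ω × Ω => X 0 p.1 - X 0 p.2) (fun n => L * b n) < ∞) :
    ∀ᵐ p ∂(P.prod P), Tendsto (fun n => (b n)⁻¹ • (partialSum X n p.1 - partialSum X n p.2))
      atTop (𝓝 0) := by
  -- The symmetric law is applied with `L * b` in place of `b`; the constant is removed from the
  -- limit afterwards.
  have hmono : MonotoneOn (fun n => L * b n / a n) (Set.Ici 1) := by
    intro i hi j hj hij
    have := mul_le_mul_of_nonneg_left (hba_mono hi hj hij) hL.le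
    simpa only [mul_div_assoc] using this
  have h := SymmetricSLLN.ae_tendsto_of_ratio ha_pos
    (fun n hn => mul_pos hL (hb_pos n hn)) ha_mono ha_top hmono hsym hX.symmetrize
    (isSymmetric_sub_prod (hX.measurable 0)) ht
  filter_upwards [h] with p hp
  have h2 := hp.const_smul L
  rw [smul_zero] at h2
  refine h2.congr fun n => ?_
  rw [partialSum_sub_prod, smul_smul, mul_inv, mul_inv_cancel_left₀ hL.ne']

end Symmetrization

/-! ### Identifying the centering with the truncated means. -/

section Centering

variable {B : Type u} [NormedAddCommGroup B] [NormedSpace ℝ B] [MeasurableSpace B] [BorelSpace B]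
variable {Ω : Type v} [MeasurableSpace Ω] {P : Measure Ω}

/-- Truncation of a vector at radius `r`. -/
noncomputable def trunc (r : ℝ) (x : B) : B := {x : B | ‖x‖ ≤ r}.indicator id x

omit [NormedSpace ℝ B] [MeasurableSpace B] [BorelSpace B] in
lemma trunc_of_le {r : ℝ} {x : B} (h : ‖x‖ ≤ r) : trunc r x = x :=
  Set.indicator_of_mem (s := {x : B | ‖x‖ ≤ r}) h id

omit [NormedSpace ℝ B] in
lemma measurable_trunc (r : ℝ) : Measurable (trunc r : B → B) :=
  measurable_id.indicator (measurableSet_le measurable_norm measurable_const)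

omit [NormedSpace ℝ B] [MeasurableSpace B] [BorelSpace B] in
lemma norm_trunc_le {r : ℝ} (hr : 0 ≤ r) (x : B) : ‖trunc r x‖ ≤ r := by
  by_cases h : ‖x‖ ≤ r
  · rwa [trunc_of_le h]
  · have : trunc r x = 0 := Set.indicator_of_notMem (s := {x : B | ‖x‖ ≤ r}) h id
    rw [this, norm_zero]
    exact hr

omit [MeasurableSpace B] [BorelSpace B] in
lemma centering_eq_integral_trunc (Y : Ω → B) (b : ℕ → ℝ) (n : ℕ) :
    centering P Y b n = (n : ℝ) • ∫ ω, trunc (b n) (Y ω) ∂P := rfl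

variable [SecondCountableTopology B] [IsProbabilityMeasure P]

omit [NormedSpace ℝ B] in
lemma integrable_trunc {Y : Ω → B} (hY : Measurable Y) {r : ℝ} (hr : 0 ≤ r) :
    Integrable (fun ω => trunc r (Y ω)) P :=
  .of_bound ((measurable_trunc r).comp hY).aestronglyMeasurable r
    (ae_of_all _ fun ω => norm_trunc_le hr (Y ω))

lemma IsIID.integral_partialSum_trunc {X : ℕ → Ω → B} (hX : IsIID P X) (b : ℕ → ℝ) {n : ℕ}
    (hb : 0 ≤ b n) :
    ∫ ω, partialSum (fun i ω => trunc (b n) (X i ω)) n ω ∂P = centering P (X 0) b n := by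
  simp only [partialSum]
  rw [integral_finsetSum _ fun i _ => integrable_trunc (hX.measurable i) hb,
    centering_eq_integral_trunc]
  have h : ∀ i, ∫ ω, trunc (b n) (X i ω) ∂P = ∫ ω, trunc (b n) (X 0 ω) ∂P := fun i =>
    ((hX.identDistrib i).comp (measurable_trunc (b n))).integral_eq
  simp_rw [h]
  simp [Nat.cast_smul_eq_nsmul]

omit [SecondCountableTopology B] [IsProbabilityMeasure P] in
omit [NormedSpace ℝ B] in
-- Finitely many early terms are overtaken by `b n → ∞`; the later ones are bounded by monotonicity.
-- Thus truncation at the common level `b n` eventually leaves the first `n` summands unchanged.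
lemma ae_eventually_forall_norm_le {X : ℕ → Ω → B} (hX : IsIID P X) {b : ℕ → ℝ}
    (hb_mono : MonotoneOn b (Set.Ici 1)) (hb_top : Tendsto b atTop atTop)
    (ht : tailSeries P (X 0) b < ∞) :
    ∀ᵐ ω ∂P, ∀ᶠ n in atTop, ∀ i < n, ‖X i ω‖ ≤ b n := by
  filter_upwards [hX.ae_eventually_norm_le ht] with ω hω
  obtain ⟨m, hm⟩ := eventually_atTop.1 hω
  have hfin : ∀ᶠ n in atTop, ∀ i ∈ Finset.range m, ‖X i ω‖ ≤ b n :=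
    (Finset.eventually_all _).2 fun i _ => hb_top.eventually_ge_atTop _
  filter_upwards [hfin] with n hn i hi
  by_cases h : i < m
  · exact hn i (Finset.mem_range.2 h)
  · refine (hm i (not_lt.1 h)).trans (hb_mono ?_ ?_ hi)
    · simp
    · simp only [Set.mem_Ici]; omega

variable [CompleteSpace B]

/-- The mean deviation of truncated partial sums is bounded by its symmetrized version. -/
lemma integral_norm_partialSum_trunc_sub_le {X : ℕ → Ω → B} (hX : IsIID P X) (b : ℕ → ℝ) {n : ℕ}
    (hb : 0 ≤ b n) :
    ∫ ω, ‖partialSum (fun i ω => trunc (b n) (X i ω)) n ω - centering P (X 0) b n‖ ∂P ≤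
      ∫ p, ‖partialSum (fun i (p : Ω × Ω) => trunc (b n) (X i p.1) - trunc (b n) (X i p.2)) n p‖
        ∂(P.prod P) := by
  set U : Ω → B := fun ω => partialSum (fun i ω => trunc (b n) (X i ω)) n ω
  set γ := centering P (X 0) b n
  have hU : Measurable U := Finset.measurable_fun_sum _ fun i _ =>
    (measurable_trunc (b n)).comp (hX.measurable i)
  have hUi : Integrable U P :=
    integrable_finsetSum _ fun i _ => integrable_trunc (hX.measurable i) hb
  have hUγ : ∫ ω, U ω ∂P = γ := hX.integral_partialSum_trunc b hb
  have hi : Integrable (fun ω => U ω - γ) P := hUi.sub (integrable_const γ)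
  have hi' : Integrable (fun ω => γ - U ω) P := (integrable_const γ).sub hUi
  have hI : IndepFun (fun p : Ω × Ω => U p.1 - γ) (fun p : Ω × Ω => γ - U p.2) (P.prod P) :=
    indepFun_prod (hU.sub_const γ) (measurable_const.sub hU)
  have h0 : ∫ p : Ω × Ω, (γ - U p.2) ∂(P.prod P) = 0 := by
    rw [integral_fun_snd (fun ω => γ - U ω), integral_sub (integrable_const γ) hUi, hUγ]
    simp
  -- The symmetrized sum is `(U - γ) + (γ - U')`, whose second term is independent and centered.
  have h := integral_norm_le_integral_norm_add ((hU.sub_const γ).comp measurable_fst)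
    ((measurable_const.sub hU).comp measurable_snd) (hi.comp_fst P) (hi'.comp_snd P) hI h0
  have e1 : ∫ p : Ω × Ω, ‖U p.1 - γ‖ ∂(P.prod P) = ∫ ω, ‖U ω - γ‖ ∂P := by
    rw [integral_fun_fst (fun ω => ‖U ω - γ‖)]
    simp
  calc ∫ ω, ‖U ω - γ‖ ∂P = ∫ p : Ω × Ω, ‖U p.1 - γ‖ ∂(P.prod P) := e1.symm
    _ ≤ ∫ p : Ω × Ω, ‖(U p.1 - γ) + (γ - U p.2)‖ ∂(P.prod P) := h
    _ = _ := by
      refine integral_congr_ae (ae_of_all _ fun p => ?_)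
      simp only [sub_add_sub_cancel]
      rw [partialSum_sub_prod (fun i ω => trunc (b n) (X i ω)) n p]

/-- If the symmetrized partial sums are `o(b n)` almost surely, then the truncated symmetrized
partial sums are `o(b n)` in mean. -/
lemma eventually_integral_norm_partialSum_trunc_le {X : ℕ → Ω → B} (hX : IsIID P X) {b : ℕ → ℝ}
    (hb_pos : ∀ n, 1 ≤ n → 0 < b n) (hb_mono : MonotoneOn b (Set.Ici 1))
    (hb_top : Tendsto b atTop atTop) (ht : tailSeries P (X 0) b < ∞)
    (hlim : ∀ᵐ p ∂(P.prod P), Tendsto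
      (fun n => (b n)⁻¹ • (partialSum X n p.1 - partialSum X n p.2)) atTop (𝓝 0))
    {ε : ℝ} (hε : 0 < ε) (hε1 : ε ≤ 1) :
    ∀ᶠ n in atTop, ∫ p, ‖partialSum
      (fun i (p : Ω × Ω) => trunc (b n) (X i p.1) - trunc (b n) (X i p.2)) n p‖ ∂(P.prod P)
        ≤ 3 * ε * b n := by
  let W : ℕ → ℕ → Ω × Ω → B := fun n i p => trunc (b n) (X i p.1) - trunc (b n) (X i p.2)
  have hWiid : ∀ n, IsIID (P.prod P) (W n) := fun n =>
    (hX.comp (measurable_trunc (b n))).symmetrize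
  have hV : ∀ n k, Measurable (partialSum (W n) k) := fun n k =>
    Finset.measurable_fun_sum _ fun i _ => (hWiid n).measurable i
  have hae := ae_eventually_forall_norm_le hX hb_mono hb_top ht
  have hae1 : ∀ᵐ p ∂(P.prod P), ∀ᶠ n in atTop, ∀ i < n, ‖X i p.1‖ ≤ b n :=
    Measure.quasiMeasurePreserving_fst.ae hae
  have hae2 : ∀ᵐ p ∂(P.prod P), ∀ᶠ n in atTop, ∀ i < n, ‖X i p.2‖ ≤ b n :=
    Measure.quasiMeasurePreserving_snd.ae hae
  let A : ℕ → Set (Ω × Ω) := fun n => {p | ∃ k ≤ n, ε * b n < ‖partialSum (W n) k p‖}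
  have hA : ∀ n, MeasurableSet (A n) := by
    intro n
    have : A n = ⋃ k, ⋃ (_ : k ≤ n), {p | ε * b n < ‖partialSum (W n) k p‖} := by
      ext p; simp [A]
    rw [this]
    exact .iUnion fun k => .iUnion fun _ => measurableSet_lt measurable_const (hV n k).norm
  have hA0 : Tendsto (fun n => (P.prod P) (A n)) atTop (𝓝 ((P.prod P) ∅)) := by
    refine tendsto_measure_of_ae_tendsto_indicator_of_isFiniteMeasure atTop .empty hA ?_
    filter_upwards [hlim, hae1, hae2] with p h1 h2 h3
    -- With slope `ε / 2`, every partial sum up to `n` is at most `C + (ε / 2) * b n`, which is at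
    -- most `ε * b n` once `b n ≥ C / (ε / 2)`.
    obtain ⟨C, hC, hT⟩ := exists_norm_le_add_mul hb_pos h1 (half_pos hε)
    filter_upwards [h2, h3, hb_top.eventually_ge_atTop (C / (ε / 2)), eventually_ge_atTop 1]
      with n hn2 hn3 hn4 hn1
    simp only [Set.mem_empty_iff_false, iff_false]
    rintro ⟨k, hk, hlt⟩
    have hbn := hb_pos n hn1
    have e : partialSum (W n) k p = partialSum X k p.1 - partialSum X k p.2 := by
      rw [← partialSum_sub_prod]
      refine Finset.sum_congr rfl fun i hi => ?_
      have hi := Finset.mem_range.1 hi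
      simp only [W]
      rw [trunc_of_le (hn2 i (by omega)), trunc_of_le (hn3 i (by omega))]
    rw [div_le_iff₀ (half_pos hε)] at hn4
    rcases Nat.eq_zero_or_pos k with rfl | hk0
    · simp only [partialSum, Finset.range_zero, Finset.sum_empty, norm_zero] at hlt
      have : 0 < ε * b n := by positivity
      linarith
    · have h4 := hT k hk0
      have h5 := mul_le_mul_of_nonneg_left
        (hb_mono (Set.mem_Ici.2 hk0) (Set.mem_Ici.2 hn1) hk) (half_pos hε).le
      rw [e] at hlt
      linarith
  have hAr : Tendsto (fun n => (P.prod P).real (A n)) atTop (𝓝 0) := by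
    have := (ENNReal.tendsto_toReal (measure_ne_top (P.prod P) ∅)).comp hA0
    simpa [Measure.real, Function.comp_def] using this
  -- With probability below `ε / 3`, the bound reads `E ≤ ε b + (ε / 3)(ε b + 2 b + E)`. Since `ε ≤
  -- 1`, this gives `(2 / 3) E ≤ 2 ε b`.
  filter_upwards [hAr.eventually (gt_mem_nhds (show (0 : ℝ) < ε / 3 by positivity)),
    eventually_ge_atTop 1] with n hn hn1
  have hbn := hb_pos n hn1
  have hW0 : ∀ i, ∫ p, W n i p ∂(P.prod P) = 0 := by
    intro i
    have hi := integrable_trunc (P := P) (hX.measurable i) hbn.le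
    simp only [W]
    rw [integral_sub (hi.comp_fst P) (hi.comp_snd P), integral_fun_fst
      (fun ω => trunc (b n) (X i ω)), integral_fun_snd (fun ω => trunc (b n) (X i ω))]
    simp
  have hWc : ∀ i p, ‖W n i p‖ ≤ 2 * b n := by
    intro i p
    refine (norm_sub_le _ _).trans ?_
    linarith [norm_trunc_le hbn.le (X i p.1), norm_trunc_le hbn.le (X i p.2)]
  have key := integral_norm_partialSum_le (hWiid n).measurable (hWiid n).indep
    (mul_pos hε hbn).le hWc hW0 n
  change ∫ p, ‖partialSum (W n) n p‖ ∂(P.prod P) ≤ 3 * ε * b n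
  set E := ∫ p, ‖partialSum (W n) n p‖ ∂(P.prod P)
  have hE0 : 0 ≤ E := integral_nonneg fun _ => norm_nonneg _
  have hs : 0 ≤ ε * b n + 2 * b n + E := by positivity
  have h1 : E ≤ ε * b n + ε / 3 * (ε * b n + 2 * b n + E) :=
    key.trans (by gcongr)
  have h2 : ε * (ε * b n) ≤ 1 * (ε * b n) := by gcongr
  have h3 : ε * E ≤ 1 * E := by gcongr
  linarith

/-- The partial sums of almost every path, taken as centering constants, are asymptotically
equivalent to the truncated means. -/
lemma tendsto_inv_smul_sub_centering {X : ℕ → Ω → B} (hX : IsIID P X) {b : ℕ → ℝ}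
    (hb_pos : ∀ n, 1 ≤ n → 0 < b n) (hb_mono : MonotoneOn b (Set.Ici 1))
    (hb_top : Tendsto b atTop atTop) (ht : tailSeries P (X 0) b < ∞)
    (hlim : ∀ᵐ p ∂(P.prod P), Tendsto
      (fun n => (b n)⁻¹ • (partialSum X n p.1 - partialSum X n p.2)) atTop (𝓝 0))
    {c : ℕ → B} (hc : ∀ᵐ ω ∂P, Tendsto (fun n => (b n)⁻¹ • (c n - partialSum X n ω)) atTop (𝓝 0)) :
    Tendsto (fun n => (b n)⁻¹ • (c n - centering P (X 0) b n)) atTop (𝓝 0) := by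
  rw [tendsto_zero_iff_norm_tendsto_zero, Metric.tendsto_atTop']
  intro δ' hδ'
  obtain ⟨δ, hδ, hδ1, hδ2⟩ : ∃ δ, 0 < δ ∧ δ ≤ 1 ∧ 2 * δ < δ' :=
    ⟨min 1 (δ' / 3), by positivity, min_le_left _ _, by linarith [min_le_right 1 (δ' / 3)]⟩
  let U : ℕ → Ω → B := fun n ω => partialSum (fun i ω => trunc (b n) (X i ω)) n ω
  have hU : ∀ n, Measurable (U n) := fun n => Finset.measurable_fun_sum _ fun i _ =>
    (measurable_trunc (b n)).comp (hX.measurable i)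
  let A : ℕ → Set Ω := fun n => {ω | δ * b n < ‖c n - U n ω‖}
  have hA : ∀ n, MeasurableSet (A n) := fun n =>
    measurableSet_lt measurable_const (measurable_const.sub (hU n)).norm
  have hA0 : Tendsto (fun n => P (A n)) atTop (𝓝 (P ∅)) := by
    refine tendsto_measure_of_ae_tendsto_indicator_of_isFiniteMeasure atTop .empty hA ?_
    filter_upwards [hc, ae_eventually_forall_norm_le hX hb_mono hb_top ht] with ω h1 h2
    filter_upwards [(tendsto_zero_iff_norm_tendsto_zero.1 h1).eventually (gt_mem_nhds hδ), h2,
      eventually_ge_atTop 1] with n hn1 hn2 hn3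
    have hbn := hb_pos n hn3
    have e : U n ω = partialSum X n ω := Finset.sum_congr rfl fun i hi =>
      trunc_of_le (hn2 i (Finset.mem_range.1 hi))
    rw [norm_smul, norm_inv, Real.norm_of_nonneg hbn.le, inv_mul_lt_iff₀ hbn] at hn1
    simp only [Set.mem_empty_iff_false, iff_false, A, Set.mem_ofPred_eq, not_lt, e]
    linarith
  have hAr : Tendsto (fun n => P.real (A n)) atTop (𝓝 0) := by
    have := (ENNReal.tendsto_toReal (measure_ne_top P ∅)).comp hA0
    simpa [Measure.real, Function.comp_def] using this
  -- The choice `ε = δ / 12` bounds the mean by `δ * b n / 4`, so Markov's inequality gives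
  -- probability at most `1 / 4`.
  have hE := eventually_integral_norm_partialSum_trunc_le hX hb_pos hb_mono hb_top ht hlim
    (ε := δ / 12) (by positivity) (by linarith)
  have hev : ∀ᶠ n in atTop, ‖(b n)⁻¹ • (c n - centering P (X 0) b n)‖ < δ' := by
    filter_upwards [hE, hAr.eventually (gt_mem_nhds (show (0 : ℝ) < 1 / 2 by norm_num)),
      eventually_ge_atTop 1] with n h1 h2 hn1
    have hbn := hb_pos n hn1
    have h3 := (integral_norm_partialSum_trunc_sub_le hX b hbn.le).trans h1
    set γ := centering P (X 0) b n
    have hi : Integrable (fun ω => ‖U n ω - γ‖) P :=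
      ((integrable_finsetSum _ fun i _ => integrable_trunc (hX.measurable i) hbn.le).sub
        (integrable_const γ)).norm
    have h4 := mul_meas_ge_le_integral_of_nonneg (ae_of_all P fun ω => norm_nonneg (U n ω - γ))
      hi (δ * b n)
    have h5 : P.real {ω | δ * b n ≤ ‖U n ω - γ‖} ≤ 1 / 4 := by
      have hδb : 0 < δ * b n := by positivity
      have : δ * b n * P.real {ω | δ * b n ≤ ‖U n ω - γ‖} ≤ δ * b n * (1 / 4) :=
        h4.trans (h3.trans (by linarith))
      exact le_of_mul_le_mul_left this hδb
    -- The exceptional sets have total probability below `1 / 2 + 1 / 4`, so one path avoids both.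
    -- It links the constants `c n` and `γ` within `2 * δ * b n`.
    obtain ⟨ω, hω⟩ : ∃ ω, ω ∉ A n ∪ {ω | δ * b n ≤ ‖U n ω - γ‖} := by
      by_contra! hcon
      have h6 : A n ∪ {ω | δ * b n ≤ ‖U n ω - γ‖} = Set.univ := Set.eq_univ_of_forall hcon
      have h7 := measureReal_union_le (μ := P) (A n) {ω | δ * b n ≤ ‖U n ω - γ‖}
      rw [h6, probReal_univ] at h7
      linarith
    simp only [Set.mem_union, A, Set.mem_ofPred_eq, not_or, not_lt, not_le] at hω
    have h6 : ‖c n - γ‖ ≤ ‖c n - U n ω‖ + ‖U n ω - γ‖ := norm_sub_le_norm_sub_add_norm_sub _ _ _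
    rw [norm_smul, norm_inv, Real.norm_of_nonneg hbn.le, inv_mul_lt_iff₀ hbn]
    have h8 : b n * (2 * δ) < b n * δ' := by gcongr
    linarith [hω.1, hω.2]
  obtain ⟨m, hm⟩ := eventually_atTop.1 hev
  refine ⟨m, fun n hn => ?_⟩
  rw [Real.dist_eq, sub_zero, abs_of_nonneg (norm_nonneg _)]
  exact hm n hn.le

end Centering

/-! ### Boundedness forces a convergent tail series. -/

section Divergence

variable {B : Type u} [NormedAddCommGroup B] [NormedSpace ℝ B] [MeasurableSpace B] [BorelSpace B]
  [SecondCountableTopology B]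
variable {Ω : Type v} [MeasurableSpace Ω] {P : Measure Ω} [IsProbabilityMeasure P]

/-- If the partial sums, centered by arbitrary constants, are `O(b n)` with positive probability,
then the tail series converges. -/
lemma tailSeries_lt_top_of_eventually_norm_sub_le
    {a b : ℕ → ℝ} (ha_pos : ∀ n, 1 ≤ n → 0 < a n) (hb_pos : ∀ n, 1 ≤ n → 0 < b n)
    (ha_mono : MonotoneOn a (Set.Ici 1)) (hb_mono : MonotoneOn b (Set.Ici 1))
    (ha_top : Tendsto a atTop atTop)
    (hba_mono : MonotoneOn (fun n => b n / a n) (Set.Ici 1)) (hsym : SymmetricSLLN B a)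
    {X : ℕ → Ω → B} (hX : IsIID P X) {c : ℕ → B} {M : ℝ} (hM : 0 ≤ M)
    (h : P {ω | ∀ᶠ n in atTop, ‖partialSum X n ω - c n‖ ≤ M * b n} ≠ 0) :
    tailSeries P (X 0) b < ∞ := by
  have hb_top := tendsto_atTop_of_ratio_monotoneOn ha_pos hb_pos ha_top hba_mono
  have hstep : ∀ (K : ℝ), 0 ≤ K → ∀ p : Ω × Ω,
      (∀ᶠ n in atTop, ‖partialSum X n p.1 - partialSum X n p.2‖ ≤ K * b n) →
      ∀ᶠ i in atTop, ‖X i p.1 - X i p.2‖ ≤ 2 * K * b (i + 1) := by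
    intro K hK p hp
    filter_upwards [hp, (tendsto_add_atTop_nat 1).eventually hp, eventually_ge_atTop 1]
      with i h1 h2 hi
    have e : X i p.1 - X i p.2 = (partialSum X (i + 1) p.1 - partialSum X (i + 1) p.2)
        - (partialSum X i p.1 - partialSum X i p.2) := by
      simp only [partialSum, Finset.sum_range_succ]
      abel
    have h3 := mul_le_mul_of_nonneg_left
      (hb_mono (Set.mem_Ici.2 hi) (Set.mem_Ici.2 (by omega : 1 ≤ i + 1)) (Nat.le_succ i)) hK
    rw [e]
    refine (norm_sub_le _ _).trans ?_
    linarith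
  -- Two copies differ by at most `2 * M * b`, so increments are at most `4 * M * b`. Adding 1 keeps
  -- the multiple positive when `M = 0`.
  have h1 : tailSeries (P.prod P) (fun p : Ω × Ω => X 0 p.1 - X 0 p.2)
      (fun n => (4 * M + 1) * b n) < ∞ := by
    refine hX.symmetrize.tailSeries_lt_top fun h0 => ?_
    set F := {ω | ∀ᶠ n in atTop, ‖partialSum X n ω - c n‖ ≤ M * b n}
    have hF : (P.prod P) (F ×ˢ F) = 0 := by
      refine measure_mono_null (fun p hp => ?_) h0
      have hp1 : ∀ᶠ n in atTop, ‖partialSum X n p.1 - c n‖ ≤ M * b n := hp.1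
      have hp2 : ∀ᶠ n in atTop, ‖partialSum X n p.2 - c n‖ ≤ M * b n := hp.2
      have hD : ∀ᶠ n in atTop, ‖partialSum X n p.1 - partialSum X n p.2‖ ≤ 2 * M * b n := by
        filter_upwards [hp1, hp2] with n h1 h2
        have : partialSum X n p.1 - partialSum X n p.2
            = (partialSum X n p.1 - c n) - (partialSum X n p.2 - c n) := by abel
        rw [this]
        refine (norm_sub_le _ _).trans ?_
        linarith
      have := hstep (2 * M) (by positivity) p hD
      change ∀ᶠ i in atTop, ‖X i p.1 - X i p.2‖ ≤ (4 * M + 1) * b (i + 1)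
      filter_upwards [this] with i hi
      linarith [hb_pos (i + 1) (by omega)]
    rw [Measure.prod_prod, mul_self_eq_zero] at hF
    exact h hF
  have h2 := ae_tendsto_symmetrized ha_pos hb_pos ha_mono ha_top hba_mono hsym hX
    (by positivity : 0 < 4 * M + 1) h1
  -- The sums are now `o(b n)`, so the multiple can be lowered: a bound `b / 4` on the sums gives `b
  -- / 2` on the increments, the threshold that desymmetrization needs.
  refine tailSeries_lt_top_of_sub_prod hb_top (hX.symmetrize.tailSeries_lt_top ?_)
  have hae : ∀ᵐ p ∂(P.prod P), ∀ᶠ i in atTop, ‖X i p.1 - X i p.2‖ ≤ 1 / 2 * b (i + 1) := by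
    filter_upwards [h2] with p hp
    have hev : ∀ᶠ n in atTop, ‖partialSum X n p.1 - partialSum X n p.2‖ ≤ 1 / 4 * b n := by
      filter_upwards [(tendsto_zero_iff_norm_tendsto_zero.1 hp).eventually
        (gt_mem_nhds (show (0 : ℝ) < 1 / 4 by norm_num)), eventually_ge_atTop 1] with n hn hn1
      have hbn := hb_pos n hn1
      rw [norm_smul, norm_inv, Real.norm_of_nonneg hbn.le, inv_mul_lt_iff₀ hbn] at hn
      linarith
    filter_upwards [hstep (1 / 4) (by norm_num) p hev] with i hi
    linarith
  have hone : (P.prod P) {p | ∀ᶠ i in atTop, ‖X i p.1 - X i p.2‖ ≤ 1 / 2 * b (i + 1)} = 1 := by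
    rw [measure_congr (eventuallyEq_univ.2 hae), measure_univ]
  rw [hone]
  exact one_ne_zero

end Divergence

end FellerSLLN

/-! ### The main theorem. -/

theorem theorem1p1 (B : Type u) [NormedAddCommGroup B] [NormedSpace ℝ B] [CompleteSpace B]
    [TopologicalSpace.SeparableSpace B] [MeasurableSpace B] [BorelSpace B]
    (a b : ℕ → ℝ)
    (ha_pos : ∀ n, 1 ≤ n → 0 < a n) (hb_pos : ∀ n, 1 ≤ n → 0 < b n)
    (ha_mono : MonotoneOn a (Set.Ici 1)) (hb_mono : MonotoneOn b (Set.Ici 1))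
    (ha_top : Tendsto a atTop atTop)
    (hba_mono : MonotoneOn (fun n => b n / a n) (Set.Ici 1))
    (hsym : FellerSLLN.SymmetricSLLN B a)
    (Ω : Type v) [MeasurableSpace Ω] (P : Measure Ω) [IsProbabilityMeasure P]
    (X : ℕ → Ω → B) (hX : FellerSLLN.IsIID P X) :
    (FellerSLLN.tailSeries P (X 0) b < ∞ →
      ∀ᵐ ω ∂P, Tendsto (fun n : ℕ => (b n)⁻¹ •
        (FellerSLLN.partialSum X n ω - FellerSLLN.centering P (X 0) b n)) atTop (𝓝 0)) ∧
    (FellerSLLN.tailSeries P (X 0) b = ∞ →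
      ∀ᵐ ω ∂P, limsup (fun n : ℕ => ENNReal.ofReal
        (‖FellerSLLN.partialSum X n ω - FellerSLLN.centering P (X 0) b n‖ / b n)) atTop = ∞) := by
  have : SecondCountableTopology B := UniformSpace.secondCountable_of_separable B
  have hb_top := FellerSLLN.tendsto_atTop_of_ratio_monotoneOn ha_pos hb_pos ha_top hba_mono
  constructor
  · intro ht
    have htD := lt_of_le_of_lt (FellerSLLN.tailSeries_sub_prod_le (P := P) (Y := X 0) b)
      (ENNReal.mul_lt_top (by simp) ht)
    have hlim := FellerSLLN.ae_tendsto_symmetrized ha_pos hb_pos ha_mono ha_top hba_mono hsym hX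
      two_pos htD
    -- Fubini: for almost every frozen first path, its partial sums act as constants centering the
    -- second copy.
    filter_upwards [Measure.ae_ae_of_ae_prod hlim] with ω hω
    exact FellerSLLN.tendsto_inv_smul_sub_centering hX hb_pos hb_mono hb_top ht hlim hω
  · intro ht
    -- Positive probability already contradicts divergence of the series, so no zero-one law is
    -- needed.
    have hnull : ∀ M : ℕ, P {ω | ∀ᶠ n in atTop,
        ‖FellerSLLN.partialSum X n ω - FellerSLLN.centering P (X 0) b n‖ ≤ M * b n} = 0 := by
      intro M
      by_contra hcon
      exact (FellerSLLN.tailSeries_lt_top_of_eventually_norm_sub_le ha_pos hb_pos ha_mono hb_mono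
        ha_top hba_mono hsym hX M.cast_nonneg hcon).ne ht
    have hae : ∀ᵐ ω ∂P, ∀ M : ℕ, ¬ ∀ᶠ n in atTop,
        ‖FellerSLLN.partialSum X n ω - FellerSLLN.centering P (X 0) b n‖ ≤ M * b n := by
      rw [ae_all_iff]
      intro M
      rw [ae_iff]
      simpa only [not_not] using hnull M
    filter_upwards [hae] with ω hω
    by_contra hcon
    obtain ⟨M, hM⟩ := ENNReal.exists_nat_gt hcon
    apply hω M
    filter_upwards [eventually_lt_of_limsup_lt hM, eventually_ge_atTop 1] with n hn hn1
    have hbn := hb_pos n hn1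
    rw [← ENNReal.ofReal_natCast, ENNReal.ofReal_lt_ofReal_iff'] at hn
    exact ((div_lt_iff₀ hbn).1 hn.1).le
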